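/- Let $p$ be a prime, $r\ge 1$ and $R=\mathbb{Z}/p^r\mathbb{Z}$. A free convolutional code of length $n$ and rank $k$ over $R$ is an $R((D))$-submodule $\mathcal{C}$ of $R((D))^n$ generated by the rows of a matrix $G\in R[D]^{k\times n}$ of full rank, i.e. with rows linearly independent over $R((D))$; such a $G$ is called a generator matrix of $\mathcal{C}$. The internal degree of $G$ is the maximum of the degrees of its $k\times k$ minors, and $G$ is a reduced internal degree matrix (RIDM) of $\mathcal{C}$ if its internal degree is minimal among all polynomial generator matrices of $\mathcal{C}$. For an RIDM $G$, let $\Delta_p(G)\in\mathbb{F}_p[D]$ be the monic greatest common divisor of the $k\times k$ minors of the reduction $\overline{G}$ of $G$ modulo $p$ (the empty minor being $1$ when $k=0$). The residual structural polynomial of $\mathcal{C}$ is $\Delta_p(\mathcal{C})=\Delta_p(G)$ for any RIDM $G$ of $\mathcal{C}$. The dual code is $$\mathcal{C}^\perp=\{v\in R((D))^n : v\,w^{T}=0 \text{ for all } w\in\mathcal{C}\}.$$ **Theorem.** Let $\mathcal{C}$ be a free convolutional code of length $n$ and rank $k$ over $\mathbb{Z}/p^r\mathbb{Z}$. Then $\mathcal{C}^\perp$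 is a free convolutional code of length $n$ and rank $n-k$, and $$\Delta_p(\mathcal{C})=\Delta_p(\mathcal{C}^\perp);$$ that is, $\Delta_p(G)=\Delta_p(H)$ for every RIDM $G$ of $\mathcal{C}$ and every RIDM $H$ of $\mathcal{C}^\perp$. -/

import Mathlib

open Polynomial LaurentSeries

noncomputable section

namespace FreeConvCode

/-- The inclusion of polynomials in the indeterminate `D` into Laurent series in `D`. -/
def polyToLaurent (R : Type*) [CommRing R] : R[X] →+* R⸨X⸩ :=
  (HahnSeries.ofPowerSeries ℤ R).comp Polynomial.coeToPowerSeries.ringHom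

/-- The polynomial matrix `G` is a generator matrix (encoder) of `C`: its rows, seen as vectors of
Laurent series, are linearly independent (`G` has full rank) and generate `C`, so that
`C = {u G : u ∈ R((D))^k}` is free of rank `k`. -/
def IsGeneratorMatrix {R : Type*} [CommRing R] {k n : ℕ}
    (C : Submodule R⸨X⸩ (Fin n → R⸨X⸩)) (G : Matrix (Fin k) (Fin n) R[X]) : Prop :=
  LinearIndependent R⸨X⸩ (G.map (polyToLaurent R)).row ∧
    Submodule.span R⸨X⸩ (Set.range (G.map (polyToLaurent R)).row) = C

/-- `C` is a free convolutional code of length `n` and rank `k` over `R`. -/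
def IsFreeCode {R : Type*} [CommRing R] {n : ℕ}
    (C : Submodule R⸨X⸩ (Fin n → R⸨X⸩)) (k : ℕ) : Prop :=
  ∃ G : Matrix (Fin k) (Fin n) R[X], IsGeneratorMatrix C G

/-- The dual code: all vectors orthogonal to every codeword for the bilinear form `v wᵀ`. -/
def dualCode {R : Type*} [CommRing R] {n : ℕ}
    (C : Submodule R⸨X⸩ (Fin n → R⸨X⸩)) : Submodule R⸨X⸩ (Fin n → R⸨X⸩) where
  carrier := {v | ∀ w ∈ C, v ⬝ᵥ w = 0}
  add_mem' := by
    intro a b ha hb w hw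
    rw [add_dotProduct, ha w hw, hb w hw, add_zero]
  zero_mem' := by
    intro w _
    exact zero_dotProduct w
  smul_mem' := by
    intro c v hv w hw
    rw [smul_dotProduct, hv w hw, smul_zero]

/-- The `k × k` minor of a `k × n` matrix on the columns selected by `e`. -/
def minor {A : Type*} [CommRing A] {k n : ℕ} (G : Matrix (Fin k) (Fin n) A)
    (e : Fin k ↪o Fin n) : A :=
  (G.submatrix id e).det

/-- The internal degree: the maximum of the degrees of the `k × k` minors. -/
def intDegree {R : Type*} [CommRing R] {k n : ℕ} (G : Matrix (Fin k) (Fin n) R[X]) : ℕ :=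
  Finset.univ.sup fun e : Fin k ↪o Fin n => (minor G e).natDegree

/-- `G` is a reduced internal degree matrix of `C`: a generator matrix of `C` whose internal
degree is minimal among all polynomial generator matrices of `C`. -/
def IsRIDM {R : Type*} [CommRing R] {k n : ℕ}
    (C : Submodule R⸨X⸩ (Fin n → R⸨X⸩)) (G : Matrix (Fin k) (Fin n) R[X]) : Prop :=
  IsGeneratorMatrix C G ∧
    ∀ G' : Matrix (Fin k) (Fin n) R[X], IsGeneratorMatrix C G' → intDegree G ≤ intDegree G'

/-- Coefficientwise reduction modulo `p`, from `(ℤ/p^r)[D]` to `(ℤ/p)[D]`. -/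
def reduction (p r : ℕ) (hr : 0 < r) : (ZMod (p ^ r))[X] →+* (ZMod p)[X] :=
  Polynomial.mapRingHom (ZMod.castHom (dvd_pow_self p hr.ne') (ZMod p))

/-- The monic greatest common divisor of the `k × k` minors of the reduction of `G` modulo `p`. -/
def residualPolynomial (p r : ℕ) [Fact p.Prime] (hr : 0 < r) {k n : ℕ}
    (G : Matrix (Fin k) (Fin n) (ZMod (p ^ r))[X]) : (ZMod p)[X] :=
  letI : NormalizedGCDMonoid (ZMod p)[X] :=
    UniqueFactorizationMonoid.toNormalizedGCDMonoid (ZMod p)[X]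
  Finset.univ.gcd fun e : Fin k ↪o Fin n => minor (G.map (reduction p r hr)) e

open Classical in
/-- The residual structural polynomial of a code: that of any reduced internal degree matrix of
the code (and `0`, a value of no significance, for a submodule that has no such matrix). -/
def codeResidualPolynomial (p r : ℕ) [Fact p.Prime] (hr : 0 < r) {n : ℕ}
    (C : Submodule (ZMod (p ^ r))⸨X⸩ (Fin n → (ZMod (p ^ r))⸨X⸩)) : (ZMod p)[X] :=
  if h : ∃ (k : ℕ) (G : Matrix (Fin k) (Fin n) (ZMod (p ^ r))[X]), IsRIDM C G then
    residualPolynomial p r hr h.choose_spec.choose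
  else 0

end FreeConvCode

end

namespace FreeConvCode

open scoped Matrix


/-! ### Lengths of modules and multiplication by a nilpotent element -/

section Length

variable {A : Type*} [CommRing A]

/-! Reduction modulo `p` does not commute with taking duals, and a single equality of lengths
measures the failure on both sides.

Minimality of the internal degree is used only through `IsRIDM.span_reduction_eq`: the reduced rows
of an RIDM span all reductions of polynomial codewords. So if `G` generates the code and `H` is an
RIDM of the dual, the rows of `H` mod `p` span the image of `ker G` inside `ker (G mod p)`.

Localize at a maximal ideal of `(ZMod p)[X]`. This gives a surjection `A → B` onto a discrete
valuation ring whose kernel is generated by the nilpotent `p`. Let `Q` be the cokernel of `G : A^n →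
A^k`. Multiplication by `p` on `Q` has cokernel `coker (G mod p)`, whose length is the order of the
gcd of the maximal minors of `G mod p`. This length is finite and `p` is nilpotent, so `Q` has
finite length, and the kernel of `p` on `Q` has the same length as the cokernel. The relation `p w =
G v` maps this kernel onto `ker (G mod p)` modulo the reductions of `ker G`, a module whose length
is the order of the gcd of the minors of `H mod p`. Hence the residual polynomial of `H` divides
that of `G` (`length_ker_quotient_le`, `dvd_minor_of_span_reduction_ker`,
`dvd_minor_of_span_eq_reduction_ker`).

The double dual is the code itself (`IsGeneratorMatrix.exists_dual`), so the roles can be exchanged.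
Two normalized polynomials that divide each other are equal. -/

theorem length_le_of_ker_le {Z X Y : Type*} [AddCommGroup Z] [AddCommGroup X] [AddCommGroup Y]
    [Module A Z] [Module A X] [Module A Y] (f : Z →ₗ[A] X) (g : Z →ₗ[A] Y)
    (hg : Function.Surjective g) (h : LinearMap.ker f ≤ LinearMap.ker g) :
    Module.length A Y ≤ Module.length A (LinearMap.range f) := by
  rw [← (f.quotKerEquivRange).length_eq]
  refine Module.length_le_of_surjective ((LinearMap.ker f).liftQ g h) ?_
  intro y
  obtain ⟨z, rfl⟩ := hg y
  exact ⟨Submodule.Quotient.mk z, by simp⟩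

/-- Filter `Q` by the images of the powers of `φ`. Each successive quotient is a quotient of `Q / φ
Q`, and the filtration reaches `0` after finitely many steps. -/
theorem length_ne_top_of_isNilpotent {Q : Type*} [AddCommGroup Q] [Module A Q]
    (φ : Module.End A Q) (hφ : IsNilpotent φ)
    (h : Module.length A (Q ⧸ LinearMap.range φ) ≠ ⊤) : Module.length A Q ≠ ⊤ := by
  have key : ∀ i : ℕ, Module.length A (Q ⧸ LinearMap.range (φ ^ i)) ≠ ⊤ := by
    intro i
    induction i with
    | zero =>
      have : Subsingleton (Q ⧸ LinearMap.range (φ ^ 0)) := by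
        rw [Submodule.Quotient.subsingleton_iff, pow_zero]
        exact LinearMap.range_id
      simp [Module.length_eq_zero]
    | succ i ih =>
      have hle : LinearMap.range (φ ^ (i + 1)) ≤ LinearMap.range (φ ^ i) := by
        rintro _ ⟨x, rfl⟩
        exact ⟨φ x, by rw [pow_succ]; rfl⟩
      let a : (Q ⧸ LinearMap.range φ) →ₗ[A] (Q ⧸ LinearMap.range (φ ^ (i + 1))) :=
        Submodule.mapQ _ _ (φ ^ i) (by
          rintro _ ⟨x, rfl⟩
          exact ⟨x, by rw [pow_succ]; rfl⟩)
      let b : (Q ⧸ LinearMap.range (φ ^ (i + 1))) →ₗ[A] (Q ⧸ LinearMap.range (φ ^ i)) :=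
        Submodule.factor hle
      have hb : Function.Surjective b := Submodule.factor_surjective hle
      have hex : Function.Exact (LinearMap.range a).subtype b := by
        intro y
        obtain ⟨y, rfl⟩ := Submodule.Quotient.mk_surjective _ y
        constructor
        · intro hy
          have hy' : y ∈ LinearMap.range (φ ^ i) := by
            rw [← Submodule.Quotient.mk_eq_zero]
            simpa [b] using hy
          obtain ⟨x, rfl⟩ := hy'
          exact ⟨⟨_, ⟨Submodule.Quotient.mk x, rfl⟩⟩, rfl⟩
        · rintro ⟨⟨_, ⟨x, rfl⟩⟩, hx⟩
          obtain ⟨x, rfl⟩ := Submodule.Quotient.mk_surjective _ x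
          rw [← hx]
          change b (Submodule.Quotient.mk ((φ ^ i) x)) = 0
          change Submodule.Quotient.mk ((φ ^ i) x) = _
          rw [Submodule.Quotient.mk_eq_zero]
          exact ⟨x, rfl⟩
      rw [Module.length_eq_add_of_exact _ _ (Submodule.injective_subtype _) hb hex]
      have h1 : Module.length A (LinearMap.range a) ≠ ⊤ :=
        ne_top_of_le_ne_top h
          (Module.length_le_of_surjective a.rangeRestrict a.surjective_rangeRestrict)
      simp [h1, ih]
  obtain ⟨i, hi⟩ := hφ
  have := key i
  rw [hi, LinearMap.range_zero] at this
  rwa [(Submodule.quotEquivOfEqBot (⊥ : Submodule A Q) rfl).length_eq] at this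

/-- A four-term exact sequence: an endomorphism of a module of finite length has kernel and
cokernel of the same length. -/
theorem length_ker_eq_length_coker {Q : Type*} [AddCommGroup Q] [Module A Q]
    (φ : Module.End A Q) (h : Module.length A Q ≠ ⊤) :
    Module.length A (LinearMap.ker φ) = Module.length A (Q ⧸ LinearMap.range φ) := by
  have h1 := Module.length_eq_add_of_exact (LinearMap.ker φ).subtype φ.rangeRestrict
    (Submodule.injective_subtype _) φ.surjective_rangeRestrict (by
      intro y
      simp [Subtype.ext_iff])
  have h2 := Module.length_eq_add_of_exact (LinearMap.range φ).subtype (LinearMap.range φ).mkQ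
    (Submodule.injective_subtype _) (Submodule.mkQ_surjective _) (by
      intro y
      simp)
  have h3 : Module.length A (LinearMap.range φ) ≠ ⊤ :=
    ne_top_of_le_ne_top h (Module.length_le_of_injective _ (Submodule.injective_subtype _))
  rw [h1, add_comm] at h2
  exact WithTop.add_left_cancel h3 h2

/-- On `Q = coker g`, multiplication by `p` has cokernel `coker g'`, and its kernel maps onto `ker
g' / L` by a connecting map of snake type. Kernel and cokernel have equal length because `Q` has
finite length. -/
theorem length_ker_quotient_le {M N M' N' : Type*} [AddCommGroup M] [AddCommGroup N]
    [AddCommGroup M'] [AddCommGroup N'] [Module A M] [Module A N] [Module A M'] [Module A N']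
    {p : A} (hp : IsNilpotent p) (πM : M →ₗ[A] M') (πN : N →ₗ[A] N')
    (hM : Function.Surjective πM) (hN : Function.Surjective πN) (hpM : ∀ x : M', p • x = 0)
    (hker : ∀ x, πN x = 0 ↔ ∃ y, x = p • y) (g : M →ₗ[A] N) (g' : M' →ₗ[A] N')
    (hg : ∀ x, g' (πM x) = πN (g x)) (L : Submodule A M') (hL : ∀ x, g x = 0 → πM x ∈ L)
    (hfin : Module.length A (N' ⧸ LinearMap.range g') ≠ ⊤) :
    Module.length A (LinearMap.ker g' ⧸ L.comap (LinearMap.ker g').subtype) ≤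
      Module.length A (N' ⧸ LinearMap.range g') := by
  let Q := N ⧸ LinearMap.range g
  let φ : Module.End A Q := LinearMap.lsmul A Q p
  have hφ : IsNilpotent φ := hp.map (Algebra.ofId A (Module.End A Q) : A →+* Module.End A Q)
  let e : Q →ₗ[A] (N' ⧸ LinearMap.range g') := Submodule.mapQ _ _ πN (by
    rintro _ ⟨x, rfl⟩
    exact ⟨πM x, hg x⟩)
  have he : Function.Surjective e := by
    intro y
    obtain ⟨y, rfl⟩ := Submodule.Quotient.mk_surjective _ y
    obtain ⟨x, rfl⟩ := hN y
    exact ⟨Submodule.Quotient.mk x, rfl⟩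
  have hek : LinearMap.ker e = LinearMap.range φ := by
    ext y
    obtain ⟨y, rfl⟩ := Submodule.Quotient.mk_surjective _ y
    constructor
    · intro hy
      have hy' : πN y ∈ LinearMap.range g' := (Submodule.Quotient.mk_eq_zero _).mp hy
      obtain ⟨x, hx⟩ := hy'
      obtain ⟨x, rfl⟩ := hM x
      rw [hg] at hx
      have : πN (y - g x) = 0 := by rw [map_sub, hx, sub_self]
      obtain ⟨z, hz⟩ := (hker _).mp this
      refine ⟨Submodule.Quotient.mk z, ?_⟩
      change Submodule.Quotient.mk (p • z) = _
      rw [← hz]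
      refine (Submodule.Quotient.eq _).mpr ⟨-x, ?_⟩
      simp
    · rintro ⟨z, hz⟩
      obtain ⟨z, rfl⟩ := Submodule.Quotient.mk_surjective _ z
      rw [← hz]
      change Submodule.Quotient.mk (πN (p • z)) = _
      rw [(hker _).mpr ⟨z, rfl⟩, Submodule.Quotient.mk_zero]
  have hlen : Module.length A (Q ⧸ LinearMap.range φ) =
      Module.length A (N' ⧸ LinearMap.range g') := by
    rw [← hek]
    exact (e.quotKerEquivOfSurjective he).length_eq
  rw [← hlen] at hfin ⊢
  rw [← length_ker_eq_length_coker φ (length_ne_top_of_isNilpotent φ hφ hfin)]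
  -- The connecting map as a correspondence: pairs `(w, v)` with `p w = g v`. The class of `w` lies
  -- in the kernel of `p` on `Q`, and it determines `πM v` modulo `L`.
  let Z : Submodule A (N × M) :=
    LinearMap.ker ((p • LinearMap.fst A N M) - g ∘ₗ LinearMap.snd A N M)
  have hZ : ∀ z : Z, p • z.1.1 = g z.1.2 := fun z => sub_eq_zero.mp z.2
  let f1 : Z →ₗ[A] Q := (LinearMap.range g).mkQ ∘ₗ LinearMap.fst A N M ∘ₗ Z.subtype
  let f2 : Z →ₗ[A] (LinearMap.ker g' ⧸ L.comap (LinearMap.ker g').subtype) :=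
    (L.comap (LinearMap.ker g').subtype).mkQ ∘ₗ
      LinearMap.codRestrict (LinearMap.ker g') (πM ∘ₗ LinearMap.snd A N M ∘ₗ Z.subtype) (by
        intro z
        rw [LinearMap.mem_ker]
        change g' (πM z.1.2) = 0
        rw [hg, ← hZ, hker]
        exact ⟨_, rfl⟩)
  have hf2 : Function.Surjective f2 := by
    intro y
    obtain ⟨⟨y, hy⟩, rfl⟩ := Submodule.Quotient.mk_surjective _ y
    obtain ⟨v, rfl⟩ := hM y
    rw [LinearMap.mem_ker, hg, hker] at hy
    obtain ⟨w, hw⟩ := hy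
    exact ⟨⟨(w, v), by simp [Z, hw]⟩, rfl⟩
  have hk : LinearMap.ker f1 ≤ LinearMap.ker f2 := by
    intro z hz
    have hz' : z.1.1 ∈ LinearMap.range g := (Submodule.Quotient.mk_eq_zero _).mp hz
    obtain ⟨u, hu⟩ := hz'
    refine (Submodule.Quotient.mk_eq_zero _).mpr ?_
    change πM z.1.2 ∈ L
    have h0 : g (z.1.2 - p • u) = 0 := by
      rw [map_sub, map_smul, hu, hZ, sub_self]
    have := hL _ h0
    rwa [map_sub, map_smul, hpM, sub_zero] at this
  refine (length_le_of_ker_le f1 f2 hf2 hk).trans ?_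
  refine Module.length_le_of_injective (Submodule.inclusion ?_)
    (Submodule.inclusion_injective _)
  rintro _ ⟨z, rfl⟩
  rw [LinearMap.mem_ker]
  change Submodule.Quotient.mk (p • z.1.1) = _
  rw [hZ, Submodule.Quotient.mk_eq_zero]
  exact ⟨_, rfl⟩

end Length

/-! ### Length of a cokernel as the order of a determinant -/

section Det

theorem ord_prod {B ι : Type*} [CommRing B] [IsDomain B] (s : Finset ι) (a : ι → B)
    (ha : ∀ i, a i ≠ 0) : Ring.ord B (∏ i ∈ s, a i) = ∑ i ∈ s, Ring.ord B (a i) := by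
  classical
  induction s using Finset.induction_on with
  | empty => simp
  | insert i s hi ih =>
    rw [Finset.prod_insert hi, Finset.sum_insert hi, Ring.ord_mul, ih]
    exact mem_nonZeroDivisors_of_ne_zero (Finset.prod_ne_zero_iff.mpr fun j _ => ha j)

/-- By Smith normal form there is a diagonal map with the same range as `f`. Both are the inclusion
of that range after an isomorphism, so their determinants are associated. -/
theorem length_quotient_range_eq_ord_det {B M ι : Type*} [CommRing B] [IsDomain B]
    [IsPrincipalIdealRing B] [AddCommGroup M] [Module B M] [Fintype ι] [DecidableEq ι]
    (b : Module.Basis ι B M) (f : M →ₗ[B] M) (hf : LinearMap.det f ≠ 0) :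
    Module.length B (M ⧸ LinearMap.range f) = Ring.ord B (LinearMap.det f) := by
  have : Module.Free B M := Module.Free.of_basis b
  have : Module.Finite B M := Module.Finite.of_basis b
  have hinj : Function.Injective f := by
    rw [← LinearMap.ker_eq_bot]
    by_contra h
    exact hf (LinearMap.det_eq_zero_iff_ker_ne_bot.mpr h)
  let e : M ≃ₗ[B] LinearMap.range f := LinearEquiv.ofInjective f hinj
  have hr : Module.finrank B (LinearMap.range f) = Module.finrank B M := e.finrank_eq.symm
  let a := Submodule.smithNormalFormCoeffs b hr
  let b' := Submodule.smithNormalFormTopBasis b hr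
  let ab := Submodule.smithNormalFormBotBasis b hr
  let e' : M ≃ₗ[B] LinearMap.range f := b'.equiv ab (Equiv.refl ι)
  have h1 : (LinearMap.range f).subtype ∘ₗ (e : M →ₗ[B] LinearMap.range f) = f := rfl
  have h2 : LinearMap.det ((LinearMap.range f).subtype ∘ₗ (e' : M →ₗ[B] LinearMap.range f)) =
      ∏ i, a i := by
    rw [← LinearMap.det_toMatrix b', ← Matrix.det_diagonal]
    congr 1
    ext i j
    rw [LinearMap.toMatrix_apply]
    have : e' (b' j) = ab j := by simp [e']
    simp only [LinearMap.comp_apply, LinearEquiv.coe_coe, this, Submodule.subtype_apply, ab,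
      Submodule.smithNormalFormBotBasis_def]
    change (b'.repr (a j • b' j)) i = _
    rw [map_smul, Module.Basis.repr_self, Finsupp.smul_apply, Finsupp.single_apply,
      Matrix.diagonal_apply]
    by_cases hij : i = j
    · subst hij
      simp
    · simp [hij, Ne.symm hij]
  have h3 : Associated (LinearMap.det f) (∏ i, a i) := by
    rw [← h2]
    conv_lhs => rw [← h1]
    exact LinearMap.associated_det_comp_equiv _ _ _
  rw [Ring.ord_eq_of_associated h3, ord_prod _ _ (Submodule.smithNormalFormCoeffs_ne_zero b hr),
    (Submodule.quotientEquivPiSpan (LinearMap.range f) b hr).length_eq,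
    Module.length_pi_of_fintype]
  rfl

end Det


/-! ### Maximal minors and linear independence of rows -/

section Minors

theorem minor_map {A B : Type*} [CommRing A] [CommRing B] {k n : ℕ} (f : A →+* B)
    (G : Matrix (Fin k) (Fin n) A) (e : Fin k ↪o Fin n) : minor (G.map f) e = f (minor G e) := by
  unfold minor
  rw [RingHom.map_det]
  rfl

theorem minor_mul {A : Type*} [CommRing A] {k n : ℕ} (T : Matrix (Fin k) (Fin k) A)
    (G : Matrix (Fin k) (Fin n) A) (e : Fin k ↪o Fin n) : minor (T * G) e = T.det * minor G e := by
  unfold minor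
  rw [← Matrix.det_mul]
  rfl

theorem dvd_det_submatrix {A : Type*} [CommRing A] {k n : ℕ} (G : Matrix (Fin k) (Fin n) A) {d : A}
    (hd : ∀ e, d ∣ minor G e) (f : Fin k → Fin n) : d ∣ (G.submatrix id f).det := by
  by_cases hf : Function.Injective f
  · have hmono : StrictMono (f ∘ Tuple.sort f) :=
      (Tuple.monotone_sort f).strictMono_of_injective (hf.comp (Tuple.sort f).injective)
    have h := hd (OrderEmbedding.ofStrictMono _ hmono)
    have h' : minor G (OrderEmbedding.ofStrictMono _ hmono) =
        ((G.submatrix id f).submatrix id (Tuple.sort f)).det := rfl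
    rw [h', Matrix.det_permute'] at h
    have hu : IsUnit (((Equiv.Perm.sign (Tuple.sort f) : ℤˣ) : ℤ) : A) := by
      have := (Equiv.Perm.sign (Tuple.sort f)).isUnit
      exact this.map (Int.castRingHom A)
    exact (hu.dvd_mul_left).mp h
  · obtain ⟨i, j, hij, hne⟩ := Function.not_injective_iff.mp hf
    rw [Matrix.det_zero_of_column_eq hne (fun r => by simp [hij])]
    exact dvd_zero d

/-- The part of Cauchy–Binet that is needed: multilinear expansion writes the determinant as a
combination of column selections of `G`, each of which is zero or a maximal minor up to sign. -/
theorem dvd_det_mul {A : Type*} [CommRing A] {k n : ℕ} (G : Matrix (Fin k) (Fin n) A)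
    (V : Matrix (Fin n) (Fin k) A) {d : A} (hd : ∀ e, d ∣ minor G e) : d ∣ (G * V).det := by
  have h : (G * V)ᵀ = fun i => ∑ j, V j i • Gᵀ j := by
    ext i l
    simp [Matrix.mul_apply, mul_comm]
  rw [← Matrix.det_transpose]
  change d ∣ Matrix.detRowAlternating (G * V)ᵀ
  rw [h]
  rw [← AlternatingMap.coe_multilinearMap, MultilinearMap.map_sum]
  refine Finset.dvd_sum fun f _ => ?_
  rw [MultilinearMap.map_smul_univ]
  refine Dvd.dvd.mul_left ?_ _
  have : d ∣ ((G.submatrix id f)ᵀ).det := by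
    rw [Matrix.det_transpose]
    exact dvd_det_submatrix G hd f
  exact this

theorem linearIndependent_row_of_minor_mem_nonZeroDivisors {A : Type*} [CommRing A] {k n : ℕ}
    (G : Matrix (Fin k) (Fin n) A) (e : Fin k ↪o Fin n) (h : minor G e ∈ nonZeroDivisors A) :
    LinearIndependent A G.row := by
  rw [← Matrix.vecMul_injective_iff]
  have hS := Matrix.vecMul_injective_iff.mpr
    (Matrix.nonsingular_iff_det_mem_nonZeroDivisors.mpr h).linearIndependent_row
  intro v w hvw
  refine hS (funext fun j => ?_)
  exact congrFun hvw (e j)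

theorem mul_transpose_toMatrix' {A ι κ μ : Type*} [CommRing A] [Fintype κ] [DecidableEq κ]
    (G : Matrix ι κ A) (f : (κ → A) →ₗ[A] (μ → A)) :
    G * (LinearMap.toMatrix' f)ᵀ = Matrix.of fun i => f (G i) := by
  ext i j
  rw [Matrix.of_apply, ← LinearMap.toMatrix'_mulVec]
  simp [Matrix.mul_apply, Matrix.mulVec, dotProduct, mul_comm]

theorem exists_minor_ne_zero {K : Type*} [Field K] {k n : ℕ} (G : Matrix (Fin k) (Fin n) K)
    (h : LinearIndependent K G.row) : ∃ e, minor G e ≠ 0 := by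
  by_contra! hcon
  have hinj : Function.Injective G.vecMulLinear := Matrix.vecMul_injective_iff.mpr h
  obtain ⟨ρ, hρ⟩ := LinearMap.exists_leftInverse_of_injective _ (LinearMap.ker_eq_bot.mpr hinj)
  have h1 : G * (LinearMap.toMatrix' ρ)ᵀ = 1 := by
    rw [mul_transpose_toMatrix']
    ext i j
    have h2 := congrFun (LinearMap.congr_fun hρ (Pi.single i 1)) j
    simpa [Matrix.one_apply, Pi.single_apply, eq_comm, Matrix.row] using h2
  -- With all minors zero, `d = 0` divides them, hence divides `det 1 = 1`.
  have h2 := dvd_det_mul G (LinearMap.toMatrix' ρ)ᵀ (d := 0) (fun e => by rw [hcon e])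
  rw [h1, Matrix.det_one] at h2
  exact one_ne_zero (zero_dvd_iff.mp h2)

theorem exists_minor_ne_zero_of_isDomain {B : Type*} [CommRing B] [IsDomain B] {k n : ℕ}
    (G : Matrix (Fin k) (Fin n) B) (h : LinearIndependent B G.row) : ∃ e, minor G e ≠ 0 := by
  let K := FractionRing B
  let ι : (Fin n → B) →ₗ[B] (Fin n → K) := (Algebra.linearMap B K).compLeft (Fin n)
  have hι : LinearMap.ker ι = ⊥ := by
    rw [LinearMap.ker_eq_bot]
    intro v w hvw
    funext i
    exact IsFractionRing.injective B K (congrFun hvw i)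
  have h1 := (LinearIndependent.iff_fractionRing B K).mp (h.map' ι hι)
  obtain ⟨e, he⟩ := exists_minor_ne_zero (G.map (algebraMap B K)) h1
  rw [minor_map] at he
  exact ⟨e, fun h0 => he (by rw [h0, map_zero])⟩

theorem linearIndependent_row_iff_exists_minor_ne_zero {B : Type*} [CommRing B] [IsDomain B]
    {k n : ℕ} (G : Matrix (Fin k) (Fin n) B) :
    LinearIndependent B G.row ↔ ∃ e, minor G e ≠ 0 :=
  ⟨exists_minor_ne_zero_of_isDomain G, fun ⟨e, he⟩ =>
    linearIndependent_row_of_minor_mem_nonZeroDivisors G e (mem_nonZeroDivisors_of_ne_zero he)⟩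

end Minors

/-! ### Square matrices carrying the image and the kernel over a principal ideal domain -/

section Local

variable {B : Type*} [CommRing B] [IsDomain B] [IsPrincipalIdealRing B]

omit [IsPrincipalIdealRing B] in
theorem finrank_range_mulVecLin {k n : ℕ} (G : Matrix (Fin k) (Fin n) B)
    (hG : ∃ e, minor G e ≠ 0) : Module.finrank B (LinearMap.range G.mulVecLin) = k := by
  obtain ⟨e, he⟩ := hG
  refine le_antisymm ((Submodule.finrank_le _).trans (by simp)) ?_
  have hinj : Function.Injective (G.submatrix id e).mulVecLin :=
    Matrix.mulVec_injective_iff.mpr (Matrix.nonsingular_iff_det_ne_zero.mpr he).linearIndependent_col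
  have hle : LinearMap.range (G.submatrix id e).mulVecLin ≤ LinearMap.range G.mulVecLin := by
    rw [Matrix.range_mulVecLin, Matrix.range_mulVecLin]
    refine Submodule.span_mono ?_
    rintro _ ⟨j, rfl⟩
    exact ⟨e j, rfl⟩
  have := Submodule.finrank_mono hle
  rwa [LinearMap.finrank_range_of_inj hinj, Module.finrank_fin_fun] at this

/-- The image of `G` is free of rank `k`, so `G` factors through it. The inclusion of the image is
the square matrix, and it has the same cokernel as `G`. -/
theorem exists_square_range_eq {k n : ℕ} (G : Matrix (Fin k) (Fin n) B)
    (hG : ∃ e, minor G e ≠ 0) : ∃ S : Matrix (Fin k) (Fin k) B, S.det ≠ 0 ∧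
      (∀ e, S.det ∣ minor G e) ∧ LinearMap.range S.mulVecLin = LinearMap.range G.mulVecLin := by
  let b : Module.Basis (Fin k) B (LinearMap.range G.mulVecLin) :=
    Module.finBasisOfFinrankEq _ _ (finrank_range_mulVecLin G hG)
  let f : (Fin k → B) →ₗ[B] (Fin k → B) :=
    (LinearMap.range G.mulVecLin).subtype ∘ₗ (b.equivFun.symm : (Fin k → B) →ₗ[B] _)
  let w : (Fin n → B) →ₗ[B] (Fin k → B) :=
    (b.equivFun : _ →ₗ[B] (Fin k → B)) ∘ₗ G.mulVecLin.rangeRestrict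
  have hfw : f ∘ₗ w = G.mulVecLin := by
    ext x i
    simp [f, w]
  have hG' : G = LinearMap.toMatrix' f * LinearMap.toMatrix' w := by
    rw [← LinearMap.toMatrix'_comp, hfw, ← Matrix.toLin'_apply', LinearMap.toMatrix'_toLin']
  have hdvd : ∀ e, (LinearMap.toMatrix' f).det ∣ minor G e := by
    intro e
    conv_rhs => rw [hG', minor_mul]
    exact Dvd.intro _ rfl
  refine ⟨LinearMap.toMatrix' f, ?_, hdvd, ?_⟩
  · obtain ⟨e, he⟩ := hG
    exact fun h0 => he (zero_dvd_iff.mp (h0 ▸ hdvd e))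
  · rw [← Matrix.toLin'_apply', Matrix.toLin'_toMatrix', LinearMap.range_comp,
      LinearEquiv.range, Submodule.map_top, Submodule.range_subtype]

/-- The image of `G` is projective, so `ker G` is a direct summand and its coordinates extend to a
map `β` on all of `B^n`. Then `S` is `H` times the transposed matrix of `β`, and `dvd_det_mul`
applies. -/
theorem exists_square_span_rows {k m n : ℕ} (hkm : k + m = n) (G : Matrix (Fin k) (Fin n) B)
    (hG : ∃ e, minor G e ≠ 0) (H : Matrix (Fin m) (Fin n) B) (hH : ∃ e, minor H e ≠ 0)
    (hGH : ∀ i, G *ᵥ H i = 0) :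
    ∃ (S : Matrix (Fin m) (Fin m) B) (b : LinearMap.ker G.mulVecLin ≃ₗ[B] (Fin m → B)),
      S.det ≠ 0 ∧ (∀ d, (∀ e, d ∣ minor H e) → d ∣ S.det) ∧
      ∀ x : LinearMap.ker G.mulVecLin, (x : Fin n → B) ∈ Submodule.span B (Set.range H.row) →
        b x ∈ LinearMap.range S.vecMulLinear := by
  have hrk : Module.finrank B (LinearMap.ker G.mulVecLin) = m := by
    have := Submodule.finrank_quotient_add_finrank (LinearMap.ker G.mulVecLin)
    rw [(G.mulVecLin.quotKerEquivRange).finrank_eq, finrank_range_mulVecLin G hG, Module.finrank_fin_fun] at this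
    omega
  let b : Module.Basis (Fin m) B (LinearMap.ker G.mulVecLin) :=
    Module.finBasisOfFinrankEq _ _ hrk
  obtain ⟨s, hs⟩ := Module.projective_lifting_property G.mulVecLin.rangeRestrict LinearMap.id
    G.mulVecLin.surjective_rangeRestrict
  have hs' : ∀ y, G *ᵥ (s y) = y := fun y => congrArg Subtype.val (LinearMap.congr_fun hs y)
  let ρ : (Fin n → B) →ₗ[B] LinearMap.ker G.mulVecLin :=
    LinearMap.codRestrict _ (LinearMap.id - s ∘ₗ G.mulVecLin.rangeRestrict) (by
      intro x
      simp [Matrix.mulVec_sub, hs'])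
  have hρ : ∀ x : LinearMap.ker G.mulVecLin, ρ x = x := by
    intro x
    have : G.mulVecLin.rangeRestrict x = 0 := Subtype.ext x.2
    apply Subtype.ext
    simp [ρ, this]
  let β : (Fin n → B) →ₗ[B] (Fin m → B) := (b.equivFun : _ →ₗ[B] (Fin m → B)) ∘ₗ ρ
  let S : Matrix (Fin m) (Fin m) B := Matrix.of fun i => β (H i)
  let W : Matrix (Fin m) (Fin n) B := Matrix.of fun i => (b i : Fin n → B)
  have hβ : ∀ x : LinearMap.ker G.mulVecLin, β x = b.equivFun x := by
    intro x
    simp [β, hρ]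
  have hSW : H = S * W := by
    ext i j
    have h1 : β (H i) = b.equivFun ⟨H i, hGH i⟩ := hβ ⟨H i, hGH i⟩
    have h2 := congrArg (fun x : LinearMap.ker G.mulVecLin => (x : Fin n → B) j)
      (b.sum_equivFun ⟨H i, hGH i⟩)
    simp only [AddSubmonoidClass.coe_finsetSum, Submodule.coe_smul, Finset.sum_apply,
      Pi.smul_apply, smul_eq_mul] at h2
    simp only [Matrix.mul_apply, S, W, Matrix.of_apply, h1, h2]
  refine ⟨S, b.equivFun, ?_, ?_, ?_⟩
  · obtain ⟨e, he⟩ := hH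
    rw [hSW, minor_mul] at he
    exact left_ne_zero_of_mul he
  · intro d hd
    have := dvd_det_mul H (LinearMap.toMatrix' β)ᵀ hd
    rwa [mul_transpose_toMatrix'] at this
  · intro x hx
    rw [← hβ]
    rw [← range_vecMulLinear] at hx
    obtain ⟨c, hc⟩ := hx
    refine ⟨c, ?_⟩
    rw [← hc, Matrix.vecMulLinear_apply, Matrix.vecMulLinear_apply, Matrix.vecMul_eq_sum,
      Matrix.vecMul_eq_sum, map_sum]
    exact Finset.sum_congr rfl fun i _ => (map_smul β _ _).symm

end Local

/-! ### The divisibility over a discrete valuation ring -/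

section DVR

variable {A B : Type*} [CommRing A] [CommRing B] [IsDomain B] [IsDiscreteValuationRing B]
  [Algebra A B]

theorem dvd_minor_of_span_reduction_ker (hAB : Function.Surjective (algebraMap A B)) {p : A}
    (hp : IsNilpotent p) (hpker : ∀ a, algebraMap A B a = 0 ↔ p ∣ a)
    {k m n : ℕ} (hkm : k + m = n) (G : Matrix (Fin k) (Fin n) A)
    (hG : ∃ e, minor (G.map (algebraMap A B)) e ≠ 0) (H : Matrix (Fin m) (Fin n) B)
    (hH : ∃ e, minor H e ≠ 0) (hGH : ∀ i, G.map (algebraMap A B) *ᵥ H i = 0)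
    (hL : ∀ v, G *ᵥ v = 0 → algebraMap A B ∘ v ∈ Submodule.span B (Set.range H.row))
    (d : B) (hd : ∀ e, d ∣ minor H e) (e : Fin k ↪o Fin n) :
    d ∣ minor (G.map (algebraMap A B)) e := by
  obtain ⟨S, hS0, hS, hSr⟩ := exists_square_range_eq _ hG
  obtain ⟨T, b, hT0, hT, hTr⟩ := exists_square_span_rows hkm _ hG H hH hGH
  refine ((hT d hd).trans ?_).trans (hS e)
  have hS0' : LinearMap.det S.mulVecLin ≠ 0 := by rwa [← Matrix.toLin'_apply', LinearMap.det_toLin']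
  have hTl : T.vecMulLinear = Tᵀ.mulVecLin := by
    ext x i
    simp
  have hT0' : LinearMap.det T.vecMulLinear ≠ 0 := by
    rwa [hTl, ← Matrix.toLin'_apply', LinearMap.det_toLin', Matrix.det_transpose]
  have hlS := length_quotient_range_eq_ord_det (Pi.basisFun B (Fin k)) _ hS0'
  have hlT := length_quotient_range_eq_ord_det (Pi.basisFun B (Fin m)) _ hT0'
  rw [← Matrix.toLin'_apply', LinearMap.det_toLin', Matrix.toLin'_apply', hSr] at hlS
  have hdT : LinearMap.det T.vecMulLinear = T.det := by
    rw [hTl, ← Matrix.toLin'_apply', LinearMap.det_toLin', Matrix.det_transpose]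
  rw [hdT] at hlT
  -- It remains to see `T.det ∣ S.det`. In a discrete valuation ring this is an inequality of
  -- orders, that is, of the lengths of the two cokernels.
  rw [← IsDiscreteValuationRing.addVal_le_iff_dvd, ← Ring.ord_eq_addVal, ← Ring.ord_eq_addVal,
    ← hlS, ← hlT]
  let g' := (G.map (algebraMap A B)).mulVecLin.restrictScalars A
  let π : ∀ j : ℕ, (Fin j → A) →ₗ[A] (Fin j → B) := fun j =>
    (Algebra.linearMap A B).compLeft (Fin j)
  have hπ : ∀ j, Function.Surjective (π j) := fun j y => by
    choose x hx using fun i => hAB (y i)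
    exact ⟨x, funext hx⟩
  have hp0 : algebraMap A B p = 0 := (hpker p).mpr dvd_rfl
  have hquot : Module.length A ((Fin k → B) ⧸ LinearMap.range g') =
      Module.length B ((Fin k → B) ⧸ LinearMap.range (G.map (algebraMap A B)).mulVecLin) := by
    rw [← Module.length_eq_of_surjective (S := A) hAB]
    exact (Submodule.Quotient.restrictScalarsEquiv A
      (LinearMap.range (G.map (algebraMap A B)).mulVecLin)).length_eq
  have key := length_ker_quotient_le hp (π n) (π k) (hπ n) (hπ k)
    (fun x => funext fun i => by simp [Algebra.smul_def, hp0])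
    (fun x => by
      constructor
      · intro hx
        choose y hy using fun i => (hpker (x i)).mp (congrFun hx i)
        exact ⟨y, funext hy⟩
      · rintro ⟨y, rfl⟩
        funext i
        simp [π, hp0])
    G.mulVecLin g'
    (fun x => by
      funext i
      simp [g', π, Matrix.mulVec, dotProduct])
    ((Submodule.span B (Set.range H.row)).restrictScalars A) hL
    (by
      rw [hquot, hlS]
      exact Ring.ord_ne_top (mem_nonZeroDivisors_of_ne_zero hS0))
  rw [hquot] at key
  refine le_trans ?_ key
  rw [← Module.length_eq_of_surjective (S := A) hAB]
  let q : LinearMap.ker g' →ₗ[A] ((Fin m → B) ⧸ LinearMap.range T.vecMulLinear) :=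
    { toFun := fun x => (LinearMap.range T.vecMulLinear).mkQ (b ⟨x.1, x.2⟩)
      map_add' := fun x y => by
        rw [← map_add, ← map_add]
        rfl
      map_smul' := fun a x => by
        have : (⟨(a • x).1, (a • x).2⟩ : LinearMap.ker (G.map (algebraMap A B)).mulVecLin) =
            algebraMap A B a • ⟨x.1, x.2⟩ := Subtype.ext (algebraMap_smul B a x.1).symm
        rw [this, map_smul, map_smul, algebraMap_smul]
        rfl }
  refine Module.length_le_of_surjective (Submodule.liftQ _ q ?_) ?_
  · intro x hx
    exact (Submodule.Quotient.mk_eq_zero _).mpr (hTr ⟨x.1, x.2⟩ hx)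
  · intro y
    obtain ⟨y, rfl⟩ := Submodule.Quotient.mk_surjective _ y
    obtain ⟨⟨x, hx⟩, rfl⟩ := b.surjective y
    exact ⟨Submodule.Quotient.mk ⟨x, hx⟩, rfl⟩

end DVR


/-! ### Reduction modulo `p`, units and Weierstrass preparation -/

theorem isUnit_of_map_of_ker_isNilpotent {A B : Type*} [CommRing A] [CommRing B] (f : A →+* B)
    (hf : Function.Surjective f) (hker : ∀ a, f a = 0 → IsNilpotent a) {a : A}
    (ha : IsUnit (f a)) : IsUnit a := by
  obtain ⟨b, hb⟩ := ha.exists_right_inv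
  obtain ⟨b, rfl⟩ := hf b
  have h : IsNilpotent (a * b - 1) := hker _ (by rw [map_sub, map_mul, hb, map_one, sub_self])
  have h2 := h.isUnit_add_one
  rw [sub_add_cancel] at h2
  exact isUnit_of_mul_isUnit_left h2

theorem polyToLaurent_injective (R : Type*) [CommRing R] :
    Function.Injective (polyToLaurent R) :=
  HahnSeries.ofPowerSeries_injective.comp (Polynomial.coe_injective R)

theorem isUnit_polyToLaurent_X (R : Type*) [CommRing R] : IsUnit (polyToLaurent R X) := by
  refine IsUnit.of_mul_eq_one (HahnSeries.single (-1 : ℤ) (1 : R)) ?_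
  have : polyToLaurent R X = HahnSeries.single (1 : ℤ) (1 : R) := by
    simp [polyToLaurent]
  rw [this, HahnSeries.single_mul_single]
  simp

section Reduction

variable {p r : ℕ} [Fact p.Prime] (hr : 0 < r)

theorem castHom_eq_zero_iff (a : ZMod (p ^ r)) :
    ZMod.castHom (dvd_pow_self p hr.ne') (ZMod p) a = 0 ↔ (p : ZMod (p ^ r)) ∣ a := by
  constructor
  · intro h
    obtain ⟨a, rfl⟩ := ZMod.intCast_surjective a
    rw [map_intCast, ZMod.intCast_zmod_eq_zero_iff_dvd] at h
    obtain ⟨b, rfl⟩ := h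
    exact ⟨(b : ZMod (p ^ r)), by push_cast; rfl⟩
  · rintro ⟨b, rfl⟩
    rw [map_mul, map_natCast, CharP.cast_eq_zero, zero_mul]

omit [Fact p.Prime] in
theorem reduction_surjective : Function.Surjective (reduction p r hr) :=
  Polynomial.map_surjective _ (ZMod.castHom_surjective _)

theorem reduction_eq_zero_iff (f : (ZMod (p ^ r))[X]) :
    reduction p r hr f = 0 ↔ (p : (ZMod (p ^ r))[X]) ∣ f := by
  have h1 : (p : (ZMod (p ^ r))[X]) = C (p : ZMod (p ^ r)) := by simp
  rw [h1, Polynomial.C_dvd_iff_dvd_coeff, Polynomial.ext_iff]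
  refine forall_congr' fun i => ?_
  rw [← castHom_eq_zero_iff hr]
  simp [reduction]

omit [Fact p.Prime] in
theorem isNilpotent_natCast (A : Type*) [CommRing A] [Algebra (ZMod (p ^ r)) A] :
    IsNilpotent (p : A) := by
  refine ⟨r, ?_⟩
  rw [← Nat.cast_pow, ← map_natCast (algebraMap (ZMod (p ^ r)) A), ZMod.natCast_self, map_zero]

theorem isNilpotent_of_reduction_eq_zero {f : (ZMod (p ^ r))[X]} (h : reduction p r hr f = 0) :
    IsNilpotent f := by
  obtain ⟨g, rfl⟩ := (reduction_eq_zero_iff hr f).mp h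
  exact (Commute.all _ _).isNilpotent_mul_right (isNilpotent_natCast (r := r) _)

theorem reduction_eq_zero_of_pow_mul_eq_zero {f : (ZMod (p ^ r))[X]}
    (h : (p : (ZMod (p ^ r))[X]) ^ (r - 1) * f = 0) : reduction p r hr f = 0 := by
  ext i
  have h1 : ((p ^ (r - 1) : ℕ) : ZMod (p ^ r)) * f.coeff i = 0 := by
    have := congrArg (fun g => g.coeff i) h
    simp only [← Nat.cast_pow, coeff_zero] at this
    rwa [← map_natCast (C : ZMod (p ^ r) →+* _), coeff_C_mul] at this
  have h2 : (reduction p r hr f).coeff i =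
    ZMod.castHom (dvd_pow_self p hr.ne') (ZMod p) (f.coeff i) := by simp [reduction]
  rw [h2, coeff_zero, castHom_eq_zero_iff hr]
  obtain ⟨a, ha⟩ := ZMod.natCast_zmod_surjective (n := p ^ r) (f.coeff i)
  rw [← ha] at h1 ⊢
  rw [← Nat.cast_mul, ZMod.natCast_eq_zero_iff] at h1
  have h3 : p ^ (r - 1) * p ∣ p ^ (r - 1) * a := by
    rwa [← pow_succ, Nat.sub_add_cancel hr]
  have h4 := Nat.dvd_of_mul_dvd_mul_left (pow_pos (Fact.out : p.Prime).pos _) h3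
  exact Nat.cast_dvd_cast h4

theorem isUnit_of_castHom_ne_zero {a : ZMod (p ^ r)}
    (h : ZMod.castHom (dvd_pow_self p hr.ne') (ZMod p) a ≠ 0) : IsUnit a := by
  refine isUnit_of_map_of_ker_isNilpotent _ (ZMod.castHom_surjective (dvd_pow_self p hr.ne'))
    (fun b hb => ?_) h.isUnit
  obtain ⟨c, rfl⟩ := (castHom_eq_zero_iff hr b).mp hb
  exact (Commute.all _ _).isNilpotent_mul_right (isNilpotent_natCast (r := r) _)

/-- Modulo a nilpotent, `f` is a power of `X` times a polynomial with unit constant term. Both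
factors are invertible as Laurent series. -/
theorem isUnit_polyToLaurent {f : (ZMod (p ^ r))[X]} (h : reduction p r hr f ≠ 0) :
    IsUnit (polyToLaurent (ZMod (p ^ r)) f) := by
  obtain ⟨j, g, hg, hfg⟩ := WfDvdMonoid.max_power_factor h Polynomial.irreducible_X
  obtain ⟨w, rfl⟩ := reduction_surjective hr g
  have h1 : reduction p r hr (f - X ^ j * w) = 0 := by
    rw [map_sub, hfg, map_mul, map_pow]
    simp [reduction]
  have hw : IsUnit (polyToLaurent (ZMod (p ^ r)) w) := by
    refine RingHom.isUnit_map (HahnSeries.ofPowerSeries ℤ (ZMod (p ^ r))) ?_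
    rw [PowerSeries.isUnit_iff_constantCoeff]
    refine isUnit_of_castHom_ne_zero hr fun h0 => hg ?_
    rw [Polynomial.X_dvd_iff]
    simpa [reduction] using h0
  have h2 : polyToLaurent (ZMod (p ^ r)) f = polyToLaurent _ (f - X ^ j * w) +
      polyToLaurent _ X ^ j * polyToLaurent _ w := by
    rw [← map_pow, ← map_mul, ← map_add, sub_add_cancel]
  rw [h2, add_comm]
  exact ((isNilpotent_of_reduction_eq_zero hr h1).map _).isUnit_add_left_of_commute
    (((isUnit_polyToLaurent_X _).pow j).mul hw) (Commute.all _ _)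

/-- Weierstrass preparation over a ring with nilpotent maximal ideal. -/
theorem exists_isUnit_mul_monic {f : (ZMod (p ^ r))[X]} (h : reduction p r hr f ≠ 0) :
    ∃ u : (ZMod (p ^ r))[X], IsUnit u ∧ (u * f).Monic := by
  have : Nontrivial (ZMod (p ^ r)) := ZMod.nontrivial_iff.mpr
    (Nat.one_lt_pow hr.ne' (Fact.out : p.Prime).one_lt).ne'
  suffices key : ∀ i : ℕ, ∃ u m z : (ZMod (p ^ r))[X], IsUnit u ∧ m.Monic ∧
      u * f = m + (p : (ZMod (p ^ r))[X]) ^ (i + 1) * z by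
    obtain ⟨u, m, z, hu, hm, hum⟩ := key (r - 1)
    have h0 : (p : (ZMod (p ^ r))[X]) ^ r = 0 := by
      rw [← Nat.cast_pow, ← map_natCast (C : ZMod (p ^ r) →+* _), ZMod.natCast_self, map_zero]
    rw [Nat.sub_add_cancel hr, h0, zero_mul, add_zero] at hum
    exact ⟨u, hu, hum ▸ hm⟩
  intro i
  induction i with
  | zero =>
    obtain ⟨c, hc⟩ := ZMod.castHom_surjective (dvd_pow_self p hr.ne') (reduction p r hr f).leadingCoeff⁻¹
    have hl : (reduction p r hr f).leadingCoeff ≠ 0 := leadingCoeff_ne_zero.mpr h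
    have hcu : IsUnit c := isUnit_of_castHom_ne_zero hr (by rw [hc]; exact inv_ne_zero hl)
    have hmon : (reduction p r hr (C c * f)).Monic := by
      rw [map_mul]
      have : reduction p r hr (C c) = C (reduction p r hr f).leadingCoeff⁻¹ := by
        rw [← hc]
        simp [reduction]
      rw [this, mul_comm]
      exact monic_mul_leadingCoeff_inv h
    have hlift : reduction p r hr (C c * f) ∈
        lifts (ZMod.castHom (dvd_pow_self p hr.ne') (ZMod p)) := ⟨C c * f, rfl⟩
    obtain ⟨m, hm, -, hmm⟩ := lifts_and_natDegree_eq_and_monic hlift hmon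
    have hz : reduction p r hr (C c * f - m) = 0 := by
      rw [map_sub, sub_eq_zero]
      exact hm.symm
    obtain ⟨z, hz⟩ := (reduction_eq_zero_iff hr _).mp hz
    refine ⟨C c, m, z, hcu.map C, hmm, ?_⟩
    rw [zero_add, pow_one, ← hz]
    ring
  | succ i ih =>
    obtain ⟨u, m, z, hu, hm, hum⟩ := ih
    set π := (p : (ZMod (p ^ r))[X]) with hπ
    have hnil : IsNilpotent (π ^ (i + 1) * (z /ₘ m)) :=
      (Commute.all _ _).isNilpotent_mul_right
        ((isNilpotent_natCast (r := r) _).pow_of_pos (Nat.succ_ne_zero i))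
    have hv := hnil.isUnit_add_one
    obtain ⟨v, hv⟩ := hv
    have hz := modByMonic_add_div z m
    have hvi : (v⁻¹ : ((ZMod (p ^ r))[X])ˣ) * (v : (ZMod (p ^ r))[X]) = 1 := v.inv_mul
    -- Write `z = s + m q` by division, so that `u f = v m + π^(i+1) s` with `v = 1 + π^(i+1) q`.
    -- After division by `v` the error is `π^(i+1) s (v⁻¹ - 1) = -π^(2i+2) s q v⁻¹`, which is
    -- divisible by `π^(i+2)`.
    refine ⟨(v⁻¹ : ((ZMod (p ^ r))[X])ˣ) * u, m + π ^ (i + 1) * (z %ₘ m),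
      - π ^ i * ((z %ₘ m) * (z /ₘ m) * (v⁻¹ : ((ZMod (p ^ r))[X])ˣ)), v⁻¹.isUnit.mul hu, ?_, ?_⟩
    · refine hm.add_of_left (lt_of_le_of_lt ?_ (degree_modByMonic_lt z hm))
      rw [hπ, ← Nat.cast_pow, ← map_natCast (C : ZMod (p ^ r) →+* _), ← smul_eq_C_mul]
      exact degree_smul_le _ _
    · rw [mul_assoc, hum]
      generalize (v⁻¹ : ((ZMod (p ^ r))[X])ˣ) = w at *
      generalize z %ₘ m = s at *
      generalize z /ₘ m = q at *
      rw [← hz]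
      rw [hv] at hvi
      linear_combination (m + π ^ (i + 1) * s) * hvi

end Reduction


/-! ### Generator matrices -/

section Generators

variable {p r : ℕ} [Fact p.Prime] (hr : 0 < r) {k n : ℕ}

theorem map_vecMul_eq {A B : Type*} [CommRing A] [CommRing B] (f : A →+* B) {k n : ℕ}
    (G : Matrix (Fin k) (Fin n) A) (c : Fin k → A) :
    (f ∘ c) ᵥ* G.map f = f ∘ (c ᵥ* G) := by
  funext i
  simp [Matrix.vecMul, dotProduct]

theorem linearIndependent_row_polyToLaurent_iff (G : Matrix (Fin k) (Fin n) (ZMod (p ^ r))[X]) :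
    LinearIndependent (ZMod (p ^ r))⸨X⸩ (G.map (polyToLaurent (ZMod (p ^ r)))).row ↔
      ∃ e, minor (G.map (reduction p r hr)) e ≠ 0 := by
  constructor
  · intro h
    refine exists_minor_ne_zero_of_isDomain _ ?_
    rw [← Matrix.vecMul_injective_iff, ← Matrix.coe_vecMulLinear, ← LinearMap.ker_eq_bot,
      LinearMap.ker_eq_bot']
    intro a ha
    choose b hb using fun i => reduction_surjective hr (a i)
    obtain rfl : reduction p r hr ∘ b = a := funext hb
    rw [Matrix.vecMulLinear_apply, map_vecMul_eq] at ha
    rw [← Matrix.vecMul_injective_iff] at h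
    -- A relation modulo `p` becomes an exact relation after multiplication by `p^(r-1)`.
    have h0 : ∀ i, (p : (ZMod (p ^ r))[X]) ^ (r - 1) * b i = 0 := by
      have h1 : ((fun i => (p : (ZMod (p ^ r))[X]) ^ (r - 1) * b i) ᵥ* G) = 0 := by
        funext j
        obtain ⟨g, hg⟩ := (reduction_eq_zero_iff hr _).mp (congrFun ha j)
        have h2 : ((fun i => (p : (ZMod (p ^ r))[X]) ^ (r - 1) * b i) ᵥ* G) j =
            (p : (ZMod (p ^ r))[X]) ^ (r - 1) * (b ᵥ* G) j := by
          simp [Matrix.vecMul, dotProduct, Finset.mul_sum, mul_assoc]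
        rw [h2, hg, ← mul_assoc, ← pow_succ, Nat.sub_add_cancel hr, ← Nat.cast_pow,
          ← map_natCast (C : ZMod (p ^ r) →+* _), ZMod.natCast_self, map_zero, zero_mul]
        rfl
      have h3 : (polyToLaurent (ZMod (p ^ r)) ∘ fun i => (p : (ZMod (p ^ r))[X]) ^ (r - 1) * b i) = 0 := by
        refine h ?_
        simp only [map_vecMul_eq, h1, Matrix.zero_vecMul]
        funext i
        simp
      intro i
      refine polyToLaurent_injective _ ?_
      rw [map_zero]
      exact congrFun h3 i
    funext i
    exact reduction_eq_zero_of_pow_mul_eq_zero hr (h0 i)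
  · rintro ⟨e, he⟩
    refine linearIndependent_row_of_minor_mem_nonZeroDivisors _ e ?_
    rw [minor_map] at he ⊢
    exact (isUnit_polyToLaurent hr he).mem_nonZeroDivisors

theorem IsGeneratorMatrix.exists_minor_ne_zero
    {C : Submodule (ZMod (p ^ r))⸨X⸩ (Fin n → (ZMod (p ^ r))⸨X⸩)}
    {G : Matrix (Fin k) (Fin n) (ZMod (p ^ r))[X]} (hG : IsGeneratorMatrix C G) :
    ∃ e, reduction p r hr (minor G e) ≠ 0 := by
  simpa only [minor_map] using (linearIndependent_row_polyToLaurent_iff hr G).mp hG.1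

theorem IsGeneratorMatrix.mem_iff {R : Type*} [CommRing R]
    {C : Submodule R⸨X⸩ (Fin n → R⸨X⸩)} {G : Matrix (Fin k) (Fin n) R[X]}
    (hG : IsGeneratorMatrix C G) (v : Fin n → R⸨X⸩) :
    v ∈ C ↔ ∃ c : Fin k → R⸨X⸩, c ᵥ* G.map (polyToLaurent R) = v := by
  rw [← hG.2, ← range_vecMulLinear]
  rfl

theorem IsGeneratorMatrix.row_mem {R : Type*} [CommRing R]
    {C : Submodule R⸨X⸩ (Fin n → R⸨X⸩)} {G : Matrix (Fin k) (Fin n) R[X]}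
    (hG : IsGeneratorMatrix C G) (i : Fin k) : polyToLaurent R ∘ G i ∈ C := by
  rw [← hG.2]
  exact Submodule.subset_span ⟨i, rfl⟩

theorem IsGeneratorMatrix.exists_mul_eq {R : Type*} [CommRing R] {l : ℕ}
    {C : Submodule R⸨X⸩ (Fin n → R⸨X⸩)} {G : Matrix (Fin k) (Fin n) R[X]}
    (hG : IsGeneratorMatrix C G) (G' : Matrix (Fin l) (Fin n) R[X])
    (hG' : ∀ i, polyToLaurent R ∘ G' i ∈ C) :
    ∃ T : Matrix (Fin l) (Fin k) R⸨X⸩,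
      G'.map (polyToLaurent R) = T * G.map (polyToLaurent R) := by
  choose c hc using fun i => (hG.mem_iff _).mp (hG' i)
  refine ⟨Matrix.of c, ?_⟩
  exact funext fun i => funext fun j => (congrFun (hc i) j).symm

/-- Any full rank polynomial matrix with rows in the code is a generator matrix. -/
theorem IsGeneratorMatrix.of_row_mem
    {C : Submodule (ZMod (p ^ r))⸨X⸩ (Fin n → (ZMod (p ^ r))⸨X⸩)}
    {G : Matrix (Fin k) (Fin n) (ZMod (p ^ r))[X]} (hG : IsGeneratorMatrix C G)
    (G' : Matrix (Fin k) (Fin n) (ZMod (p ^ r))[X])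
    (hG' : ∀ i, polyToLaurent (ZMod (p ^ r)) ∘ G' i ∈ C)
    (hmin : ∃ e, reduction p r hr (minor G' e) ≠ 0) : IsGeneratorMatrix C G' := by
  have hli := (linearIndependent_row_polyToLaurent_iff hr G').mpr (by simpa only [minor_map] using hmin)
  refine ⟨hli, le_antisymm ?_ ?_⟩
  · rw [Submodule.span_le]
    rintro _ ⟨i, rfl⟩
    exact hG' i
  · obtain ⟨T, hT⟩ := hG.exists_mul_eq G' hG'
    obtain ⟨e, he⟩ := hmin
    have h1 : polyToLaurent (ZMod (p ^ r)) (minor G' e) =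
        T.det * minor (G.map (polyToLaurent (ZMod (p ^ r)))) e := by
      rw [← minor_map, hT, minor_mul]
    have hu : IsUnit T.det := isUnit_of_mul_isUnit_left (h1 ▸ isUnit_polyToLaurent hr he)
    intro v hv
    obtain ⟨c, rfl⟩ := (hG.mem_iff v).mp hv
    rw [← range_vecMulLinear]
    refine ⟨c ᵥ* T⁻¹, ?_⟩
    rw [Matrix.vecMulLinear_apply, hT, Matrix.vecMul_vecMul, ← Matrix.mul_assoc,
      Matrix.nonsing_inv_mul _ hu, Matrix.one_mul]

theorem IsGeneratorMatrix.minor_mul_minor {R : Type*} [CommRing R]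
    {C : Submodule R⸨X⸩ (Fin n → R⸨X⸩)} {G G' : Matrix (Fin k) (Fin n) R[X]}
    (hG : IsGeneratorMatrix C G) (hG' : IsGeneratorMatrix C G') (e f : Fin k ↪o Fin n) :
    minor G' e * minor G f = minor G e * minor G' f := by
  obtain ⟨T, hT⟩ := hG.exists_mul_eq G' hG'.row_mem
  apply polyToLaurent_injective
  rw [map_mul, map_mul, ← minor_map, ← minor_map, ← minor_map, ← minor_map, hT, minor_mul,
    minor_mul]
  ring

theorem IsGeneratorMatrix.mem_dualCode_iff {R : Type*} [CommRing R]
    {C : Submodule R⸨X⸩ (Fin n → R⸨X⸩)} {G : Matrix (Fin k) (Fin n) R[X]}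
    (hG : IsGeneratorMatrix C G) (v : Fin n → R⸨X⸩) :
    v ∈ dualCode C ↔ G.map (polyToLaurent R) *ᵥ v = 0 := by
  constructor
  · intro h
    funext i
    rw [Matrix.mulVec, dotProduct_comm]
    exact h _ (hG.row_mem i)
  · intro h w hw
    obtain ⟨c, rfl⟩ := (hG.mem_iff w).mp hw
    rw [dotProduct_comm, ← Matrix.dotProduct_mulVec, h, dotProduct_zero]

end Generators

/-! ### Parity check matrices and the double dual -/

section Dual

theorem exists_complement {k n : ℕ} (e : Fin k ↪o Fin n) :
    ∃ (f : Fin (n - k) ↪o Fin n) (σ : Fin k ⊕ Fin (n - k) ≃ Fin n),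
      (∀ i, σ (Sum.inl i) = e i) ∧ ∀ j, σ (Sum.inr j) = f j := by
  let s : Finset (Fin n) := (Finset.univ.map e.toEmbedding)ᶜ
  have hs : s.card = n - k := by simp [s, Finset.card_compl]
  let f := s.orderEmbOfFin hs
  have hf : ∀ j i, e i ≠ f j := by
    intro j i h
    have := s.orderEmbOfFin_mem hs j
    simp only [s, Finset.mem_compl, Finset.mem_map, not_exists, not_and] at this
    exact this i (Finset.mem_univ _) h
  refine ⟨f, Equiv.ofBijective (Sum.elim e f) ⟨?_, ?_⟩, fun _ => rfl, fun _ => rfl⟩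
  · exact e.injective.sumElim f.injective fun i j => hf j i
  · intro x
    by_cases hx : x ∈ s
    · have : x ∈ Set.range f := by
        rw [Finset.range_orderEmbOfFin]
        exact hx
      obtain ⟨j, rfl⟩ := this
      exact ⟨Sum.inr j, rfl⟩
    · simp only [s, Finset.mem_compl, not_not, Finset.mem_map] at hx
      obtain ⟨i, -, rfl⟩ := hx
      exact ⟨Sum.inl i, rfl⟩

/-- The parity check matrix attached to an invertible minor of a generator matrix. -/
noncomputable def parityCheck {A : Type*} [CommRing A] {k m n : ℕ} (G : Matrix (Fin k) (Fin n) A)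
    (e : Fin k ↪o Fin n) (σ : Fin k ⊕ Fin m ≃ Fin n) : Matrix (Fin m) (Fin n) A :=
  Matrix.of fun j l => Sum.elim
    (fun i => -((G.submatrix id e).adjugate * G) i (σ (Sum.inr j)))
    (fun j' => if j' = j then minor G e else 0) (σ.symm l)

section ParityCheck

variable {A : Type*} [CommRing A] {k m n : ℕ} (G : Matrix (Fin k) (Fin n) A)
    (e : Fin k ↪o Fin n) (σ : Fin k ⊕ Fin m ≃ Fin n)

theorem map_parityCheck {B : Type*} [CommRing B] (f : A →+* B) :
    (parityCheck G e σ).map f = parityCheck (G.map f) e σ := by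
  ext j l
  have h : ((G.map f).submatrix id e).adjugate = ((G.submatrix id e).adjugate).map f := by
    have := RingHom.map_adjugate f (G.submatrix id e)
    exact this.symm
  simp only [parityCheck, Matrix.map_apply, Matrix.of_apply, h, ← Matrix.map_mul, minor_map]
  cases σ.symm l with
  | inl i => simp
  | inr j' =>
    simp only [Sum.elim_inr]
    split_ifs <;> simp

theorem adjugate_mul_apply_embedding (i i' : Fin k) :
    ((G.submatrix id e).adjugate * G) i (e i') = if i = i' then minor G e else 0 := by
  have := congrFun (congrFun (Matrix.adjugate_mul (G.submatrix id e)) i) i'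
  rw [Matrix.smul_apply, Matrix.one_apply, smul_ite, smul_zero, smul_eq_mul, mul_one] at this
  exact this

theorem parityCheck_mulVec (v : Fin n → A) (hσ : ∀ i, σ (Sum.inl i) = e i) (j : Fin m) :
    (parityCheck G e σ *ᵥ v) j = minor G e * v (σ (Sum.inr j)) -
      ((v ∘ e) ᵥ* ((G.submatrix id e).adjugate * G)) (σ (Sum.inr j)) := by
  rw [Matrix.mulVec, dotProduct, ← σ.sum_comp, Fintype.sum_sum_type]
  simp only [parityCheck, Matrix.of_apply, Equiv.symm_apply_apply, Sum.elim_inl, Sum.elim_inr]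
  simp only [ite_mul, zero_mul, Finset.sum_ite_eq', Finset.mem_univ, if_true, hσ]
  rw [Matrix.vecMul, dotProduct, add_comm, sub_eq_add_neg, ← Finset.sum_neg_distrib]
  simp [mul_comm]

/-- Using the adjugate and multiplying by the minor, instead of inverting it, makes the identity
valid over any commutative ring. It serves both for Laurent series, where the minor is a unit, and
for polynomials. -/
theorem smul_eq_of_parityCheck_mulVec_eq_zero (v : Fin n → A) (hσ : ∀ i, σ (Sum.inl i) = e i)
    (h : parityCheck G e σ *ᵥ v = 0) :
    minor G e • v = (v ∘ e) ᵥ* ((G.submatrix id e).adjugate * G) := by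
  funext l
  obtain ⟨l, rfl⟩ := σ.surjective l
  cases l with
  | inl i =>
    rw [hσ, Matrix.vecMul, dotProduct]
    simp only [adjugate_mul_apply_embedding G e]
    simp [mul_comm]
  | inr j =>
    have := congrFun h j
    rw [parityCheck_mulVec G e σ v hσ] at this
    exact sub_eq_zero.mp this

theorem parityCheck_mulVec_vecMul (c : Fin k → A) (hσ : ∀ i, σ (Sum.inl i) = e i) :
    parityCheck G e σ *ᵥ (c ᵥ* G) = 0 := by
  funext j
  have h : (c ᵥ* G) ∘ e = c ᵥ* G.submatrix id e := rfl
  rw [parityCheck_mulVec G e σ _ hσ, h, ← Matrix.vecMul_vecMul, Matrix.vecMul_vecMul c,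
    Matrix.mul_adjugate, Matrix.vecMul_smul, Matrix.vecMul_one, Matrix.smul_vecMul]
  exact sub_self _

theorem smul_eq_vecMul_parityCheck (v : Fin n → A) (hσ : ∀ i, σ (Sum.inl i) = e i)
    (h : G *ᵥ v = 0) :
    minor G e • v = (fun j => v (σ (Sum.inr j))) ᵥ* parityCheck G e σ := by
  have h1 : ((G.submatrix id e).adjugate * G) *ᵥ v = 0 := by
    rw [← Matrix.mulVec_mulVec, h, Matrix.mulVec_zero]
  funext l
  obtain ⟨l, rfl⟩ := σ.surjective l
  cases l with
  | inl i =>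
    have h2 := congrFun h1 i
    rw [Matrix.mulVec, dotProduct, ← σ.sum_comp, Fintype.sum_sum_type] at h2
    simp only [hσ, adjugate_mul_apply_embedding G e] at h2
    simp only [ite_mul, zero_mul, Finset.sum_ite_eq, Finset.mem_univ, if_true, Pi.zero_apply] at h2
    rw [Matrix.vecMul, dotProduct]
    simp only [parityCheck, Matrix.of_apply, Equiv.symm_apply_apply, Sum.elim_inl, Pi.smul_apply,
      smul_eq_mul, mul_neg, Finset.sum_neg_distrib]
    rw [eq_neg_iff_add_eq_zero, ← h2, hσ]
    simp [mul_comm]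
  | inr j =>
    rw [Matrix.vecMul, dotProduct]
    simp [parityCheck, mul_comm]

theorem minor_parityCheck (f : Fin m ↪o Fin n) (hf : ∀ j, σ (Sum.inr j) = f j) :
    minor (parityCheck G e σ) f = minor G e ^ m := by
  have : (parityCheck G e σ).submatrix id f = Matrix.diagonal fun _ => minor G e := by
    ext j j'
    simp only [Matrix.submatrix_apply, parityCheck, Matrix.of_apply, ← hf, Equiv.symm_apply_apply,
      Sum.elim_inr, Matrix.diagonal_apply, id]
    simp [eq_comm]
  rw [minor, this, Matrix.det_diagonal]
  simp

end ParityCheck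

variable {p r : ℕ} [Fact p.Prime] (hr : 0 < r) {k n : ℕ}
  {C : Submodule (ZMod (p ^ r))⸨X⸩ (Fin n → (ZMod (p ^ r))⸨X⸩)}

include hr in
theorem IsGeneratorMatrix.exists_dual {G : Matrix (Fin k) (Fin n) (ZMod (p ^ r))[X]}
    (hG : IsGeneratorMatrix C G) : IsFreeCode (dualCode C) (n - k) ∧ dualCode (dualCode C) = C := by
  obtain ⟨e, he⟩ := hG.exists_minor_ne_zero hr
  obtain ⟨f, σ, hσ, hf⟩ := exists_complement e
  set τ := polyToLaurent (ZMod (p ^ r))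
  have hu : IsUnit (minor (G.map τ) e) := by
    rw [minor_map]
    exact isUnit_polyToLaurent hr he
  have hrow : ∀ j, (parityCheck (G.map τ) e σ) j ∈ dualCode C := by
    intro j w hw
    obtain ⟨c, rfl⟩ := (hG.mem_iff w).mp hw
    exact congrFun (parityCheck_mulVec_vecMul (G.map τ) e σ c hσ) j
  refine ⟨⟨parityCheck G e σ, ?_, le_antisymm ?_ ?_⟩, le_antisymm ?_ ?_⟩
  · rw [linearIndependent_row_polyToLaurent_iff hr]
    refine ⟨f, ?_⟩
    rw [minor_map, minor_parityCheck G e σ f hf, map_pow]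
    exact pow_ne_zero _ he
  · rw [map_parityCheck, Submodule.span_le]
    rintro _ ⟨j, rfl⟩
    exact hrow j
  · intro v hv
    rw [hG.mem_dualCode_iff] at hv
    have h := smul_eq_vecMul_parityCheck (G.map τ) e σ v hσ hv
    rw [map_parityCheck, ← range_vecMulLinear]
    rw [← Submodule.smul_mem_iff_of_isUnit _ hu, h]
    exact ⟨_, rfl⟩
  · intro v hv
    have h0 : parityCheck (G.map τ) e σ *ᵥ v = 0 := by
      funext j
      rw [Matrix.mulVec, dotProduct_comm]
      exact hv _ (hrow j)
    have h := smul_eq_of_parityCheck_mulVec_eq_zero (G.map τ) e σ v hσ h0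
    rw [← Submodule.smul_mem_iff_of_isUnit _ hu, h, hG.mem_iff]
    exact ⟨_, Matrix.vecMul_vecMul _ _ _⟩
  · intro v hv w hw
    rw [dotProduct_comm]
    exact hw v hv

end Dual


/-! ### The residue code and its description by an RIDM -/

section ResidueCode

variable {p r : ℕ} [Fact p.Prime] (hr : 0 < r) {k n : ℕ}

/-- The reductions modulo `p` of the polynomial codewords. -/
noncomputable def residueCode (C : Submodule (ZMod (p ^ r))⸨X⸩ (Fin n → (ZMod (p ^ r))⸨X⸩)) :
    Submodule (ZMod p)[X] (Fin n → (ZMod p)[X]) where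
  carrier := {w | ∃ v : Fin n → (ZMod (p ^ r))[X],
    polyToLaurent (ZMod (p ^ r)) ∘ v ∈ C ∧ reduction p r hr ∘ v = w}
  add_mem' := by
    rintro _ _ ⟨v, hv, rfl⟩ ⟨w, hw, rfl⟩
    refine ⟨v + w, ?_, funext fun i => by simp⟩
    convert C.add_mem hv hw using 1
    exact funext fun i => by simp
  zero_mem' := by
    refine ⟨0, ?_, funext fun i => by simp⟩
    convert C.zero_mem using 1
    exact funext fun i => by simp
  smul_mem' := by
    rintro a _ ⟨v, hv, rfl⟩
    obtain ⟨b, rfl⟩ := reduction_surjective hr a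
    refine ⟨b • v, ?_, funext fun i => by simp⟩
    convert C.smul_mem (polyToLaurent _ b) hv using 1
    exact funext fun i => by simp

variable {C : Submodule (ZMod (p ^ r))⸨X⸩ (Fin n → (ZMod (p ^ r))⸨X⸩)}

theorem IsGeneratorMatrix.span_reduction_le {G : Matrix (Fin k) (Fin n) (ZMod (p ^ r))[X]}
    (hG : IsGeneratorMatrix C G) :
    Submodule.span (ZMod p)[X] (Set.range (G.map (reduction p r hr)).row) ≤ residueCode hr C := by
  rw [Submodule.span_le]
  rintro _ ⟨i, rfl⟩
  exact ⟨G i, hG.row_mem i, rfl⟩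

theorem IsGeneratorMatrix.minor_smul_mem_span {G : Matrix (Fin k) (Fin n) (ZMod (p ^ r))[X]}
    (hG : IsGeneratorMatrix C G) (e : Fin k ↪o Fin n) {w : Fin n → (ZMod p)[X]}
    (hw : w ∈ residueCode hr C) : minor (G.map (reduction p r hr)) e • w ∈
      Submodule.span (ZMod p)[X] (Set.range (G.map (reduction p r hr)).row) := by
  obtain ⟨v, hv, rfl⟩ := hw
  obtain ⟨f, σ, hσ, hf⟩ := exists_complement e
  have h0 : parityCheck G e σ *ᵥ v = 0 := by
    obtain ⟨c, hc⟩ := (hG.mem_iff _).mp hv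
    have h1 := parityCheck_mulVec_vecMul (G.map (polyToLaurent (ZMod (p ^ r)))) e σ c hσ
    rw [hc, ← map_parityCheck] at h1
    funext j
    apply polyToLaurent_injective
    rw [RingHom.map_mulVec]
    simpa using congrFun h1 j
  have h2 := smul_eq_of_parityCheck_mulVec_eq_zero G e σ v hσ h0
  rw [← Matrix.vecMul_vecMul] at h2
  have h3 : minor (G.map (reduction p r hr)) e • (reduction p r hr ∘ v) =
      reduction p r hr ∘ (minor G e • v) := by
    funext i
    simp [minor_map]
  rw [h3, h2, ← map_vecMul_eq, ← range_vecMulLinear]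
  exact ⟨_, rfl⟩

/-- The residue code contains the span of the reduced rows, and a nonzero minor multiplies it back
into that span. -/
theorem IsGeneratorMatrix.finrank_residueCode {G : Matrix (Fin k) (Fin n) (ZMod (p ^ r))[X]}
    (hG : IsGeneratorMatrix C G) : Module.finrank (ZMod p)[X] (residueCode hr C) = k := by
  have hex : ∃ e, minor (G.map (reduction p r hr)) e ≠ 0 :=
    (linearIndependent_row_polyToLaurent_iff hr G).mp hG.1
  have hli := (linearIndependent_row_iff_exists_minor_ne_zero _).mpr hex
  have hk : Module.finrank (ZMod p)[X] (Submodule.span (ZMod p)[X]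
      (Set.range (G.map (reduction p r hr)).row)) = k := by
    rw [finrank_span_eq_card hli, Fintype.card_fin]
  obtain ⟨e, he⟩ := hex
  refine le_antisymm ?_ ?_
  · rw [← hk]
    let φ : residueCode hr C →ₗ[(ZMod p)[X]] Submodule.span (ZMod p)[X]
        (Set.range (G.map (reduction p r hr)).row) :=
      LinearMap.codRestrict _
        ((minor (G.map (reduction p r hr)) e) • (residueCode hr C).subtype)
        (fun w => hG.minor_smul_mem_span hr e w.2)
    refine LinearMap.finrank_le_finrank_of_injective (f := φ) fun v w hvw => ?_
    have h1 : minor (G.map (reduction p r hr)) e • (v : Fin n → (ZMod p)[X]) =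
        minor (G.map (reduction p r hr)) e • (w : Fin n → (ZMod p)[X]) :=
      congrArg Subtype.val hvw
    exact Subtype.ext (smul_right_injective _ he h1)
  · rw [← hk]
    exact Submodule.finrank_mono (hG.span_reduction_le hr)

theorem IsGeneratorMatrix.exists_span_reduction_eq
    {G : Matrix (Fin k) (Fin n) (ZMod (p ^ r))[X]} (hG : IsGeneratorMatrix C G) :
    ∃ G₀ : Matrix (Fin k) (Fin n) (ZMod (p ^ r))[X], IsGeneratorMatrix C G₀ ∧
      Submodule.span (ZMod p)[X] (Set.range (G₀.map (reduction p r hr)).row) =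
        residueCode hr C := by
  let b : Module.Basis (Fin k) (ZMod p)[X] (residueCode hr C) :=
    Module.finBasisOfFinrankEq _ _ (hG.finrank_residueCode hr)
  choose G₀ hG₀ hG₀b using fun i => (b i).2
  have hrow : ((Matrix.of G₀).map (reduction p r hr)).row =
      fun i => ((residueCode hr C).subtype (b i)) := funext hG₀b
  refine ⟨Matrix.of G₀, hG.of_row_mem hr _ hG₀ ?_, ?_⟩
  · simp only [← minor_map]
    refine exists_minor_ne_zero_of_isDomain _ ?_
    rw [hrow]
    exact b.linearIndependent.map' _ (Submodule.ker_subtype _)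
  · rw [hrow, Set.range_comp', Submodule.span_image, b.span_eq, Submodule.map_top,
      Submodule.range_subtype]

theorem IsGeneratorMatrix.mul_row_mem {R : Type*} [CommRing R] {l : ℕ}
    {C : Submodule R⸨X⸩ (Fin n → R⸨X⸩)} {G : Matrix (Fin k) (Fin n) R[X]}
    (hG : IsGeneratorMatrix C G) (T : Matrix (Fin l) (Fin k) R[X]) (i : Fin l) :
    polyToLaurent R ∘ (T * G) i ∈ C := by
  rw [hG.mem_iff]
  exact ⟨polyToLaurent R ∘ T i, map_vecMul_eq _ _ _⟩

theorem natDegree_isUnit_mul {F : Type*} [Field F] {u f : F[X]} (hu : IsUnit u) :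
    (u * f).natDegree = f.natDegree := by
  by_cases hf : f = 0
  · simp [hf]
  · rw [natDegree_mul hu.ne_zero hf, natDegree_eq_zero_of_isUnit hu, zero_add]

theorem natDegree_minor_le_intDegree {R : Type*} [CommRing R]
    (G : Matrix (Fin k) (Fin n) R[X]) (e : Fin k ↪o Fin n) :
    (minor G e).natDegree ≤ intDegree G :=
  Finset.le_sup (f := fun e : Fin k ↪o Fin n => (minor G e).natDegree) (Finset.mem_univ e)

/-- Rescaling a generator matrix by a unit makes its internal degree comparable with that of any
other generator matrix. -/
theorem IsGeneratorMatrix.exists_intDegree_add_le [NeZero k]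
    {G G₀ : Matrix (Fin k) (Fin n) (ZMod (p ^ r))[X]}
    (hG : IsGeneratorMatrix C G) (hG₀ : IsGeneratorMatrix C G₀) (e : Fin k ↪o Fin n)
    (he : reduction p r hr (minor G e) ≠ 0) (he₀ : reduction p r hr (minor G₀ e) ≠ 0) :
    ∃ G₁ : Matrix (Fin k) (Fin n) (ZMod (p ^ r))[X], IsGeneratorMatrix C G₁ ∧
      intDegree G₁ + (reduction p r hr (minor G e)).natDegree ≤
        intDegree G + (reduction p r hr (minor G₀ e)).natDegree := by
  have : Nontrivial (ZMod (p ^ r)) := ZMod.nontrivial_iff.mpr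
    (Nat.one_lt_pow hr.ne' (Fact.out : p.Prime).one_lt).ne'
  -- Over `ZMod (p ^ r)` degrees need not add in products. Once the two minors on `e` are made monic
  -- by units, their degrees add and equal those of their reductions.
  obtain ⟨_, ⟨u, rfl⟩, hy⟩ := exists_isUnit_mul_monic hr he
  obtain ⟨_, ⟨u₀, rfl⟩, hx⟩ := exists_isUnit_mul_monic hr he₀
  have hdeg : ∀ (w : ((ZMod (p ^ r))[X])ˣ) (f : (ZMod (p ^ r))[X]), (↑w * f).Monic →
      (↑w * f).natDegree = (reduction p r hr f).natDegree := by
    intro w f hf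
    rw [← natDegree_isUnit_mul (w.isUnit.map (reduction p r hr)), ← map_mul]
    exact (hf.natDegree_map _).symm
  let D : Matrix (Fin k) (Fin k) (ZMod (p ^ r))[X] :=
    Matrix.diagonal (Function.update 1 0 (↑u₀ * ↑u⁻¹ : (ZMod (p ^ r))[X]))
  have hD : D.det = ↑u₀ * ↑u⁻¹ := by
    rw [Matrix.det_diagonal, Finset.prod_update_of_mem (Finset.mem_univ _)]
    simp
  have hmin : ∀ f, minor (D * G₀) f = ↑u₀ * ↑u⁻¹ * minor G₀ f := fun f => by
    rw [minor_mul, hD]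
  refine ⟨D * G₀, hG₀.of_row_mem hr _ (hG₀.mul_row_mem D) ⟨e, ?_⟩, ?_⟩
  · rw [hmin, map_mul]
    exact mul_ne_zero ((u₀ * u⁻¹).isUnit.map (reduction p r hr)).ne_zero he₀
  have hrel : ∀ f, (↑u * minor G e) * minor (D * G₀) f = (↑u₀ * minor G₀ e) * minor G f := by
    intro f
    have h1 := hG₀.minor_mul_minor hG e f
    have h2 : (u : (ZMod (p ^ r))[X]) * ↑u⁻¹ = 1 := u.mul_inv
    rw [hmin]
    linear_combination (u₀ : (ZMod (p ^ r))[X]) * h1 +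
      (u₀ : (ZMod (p ^ r))[X]) * minor G e * minor G₀ f * h2
  have hle : ∀ f, minor (D * G₀) f ≠ 0 → (minor (D * G₀) f).natDegree +
      (reduction p r hr (minor G e)).natDegree ≤
        intDegree G + (reduction p r hr (minor G₀ e)).natDegree := by
    intro f hf
    have hf' : minor G f ≠ 0 := by
      intro h0
      have := hrel f
      rw [h0, mul_zero] at this
      exact hf ((hy.mul_right_eq_zero_iff).mp this)
    have h1 := congrArg natDegree (hrel f)
    rw [hy.natDegree_mul' hf, hx.natDegree_mul' hf', hdeg u _ hy, hdeg u₀ _ hx] at h1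
    have h2 := natDegree_minor_le_intDegree G f
    omega
  have hle' : ∀ f, (minor (D * G₀) f).natDegree +
      (reduction p r hr (minor G e)).natDegree ≤
        intDegree G + (reduction p r hr (minor G₀ e)).natDegree := by
    intro f
    -- A zero minor has `natDegree` zero, and the bound then follows from the one for the nonzero
    -- minor on `e`.
    by_cases hf : minor (D * G₀) f = 0
    · have h0 : minor (D * G₀) e ≠ 0 := by
        intro h
        rw [hmin, ← Units.val_mul, (u₀ * u⁻¹).isUnit.mul_right_eq_zero] at h
        exact he₀ (by rw [h, map_zero])
      have := hle e h0
      rw [hf, natDegree_zero]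
      omega
    · exact hle f hf
  obtain ⟨f, -, hf⟩ := Finset.exists_mem_eq_sup (Finset.univ : Finset (Fin k ↪o Fin n)) ⟨e, Finset.mem_univ e⟩
    (fun f => (minor (D * G₀) f).natDegree)
  rw [show intDegree (D * G₀) = (minor (D * G₀) f).natDegree from hf]
  exact hle' f

/-- Let `G₀` be a generator matrix lifting a basis of the residue code. Modulo `p`, `G = T G₀`, and
a rescaled `G₀` has internal degree smaller than that of `G` by at least `deg det T`. Minimality
makes `det T` a nonzero constant. -/
theorem IsRIDM.span_reduction_eq {G : Matrix (Fin k) (Fin n) (ZMod (p ^ r))[X]}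
    (hG : IsRIDM C G) :
    Submodule.span (ZMod p)[X] (Set.range (G.map (reduction p r hr)).row) =
      residueCode hr C := by
  refine le_antisymm (hG.1.span_reduction_le hr) ?_
  obtain ⟨G₀, hG₀, hspan⟩ := hG.1.exists_span_reduction_eq hr
  have hrow : ∀ i, ∃ c, c ᵥ* G₀.map (reduction p r hr) = G.map (reduction p r hr) i := by
    intro i
    have : G.map (reduction p r hr) i ∈ residueCode hr C := ⟨G i, hG.1.row_mem i, rfl⟩
    rwa [← hspan, ← range_vecMulLinear] at this
  choose T hT using hrow
  have hT' : G.map (reduction p r hr) = Matrix.of T * G₀.map (reduction p r hr) :=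
    funext fun i => (hT i).symm
  have hu : IsUnit (Matrix.of T).det := by
    -- The rescaling acts on row `0`, so the empty matrix is treated apart.
    rcases Nat.eq_zero_or_pos k with rfl | hk
    · simp
    have : NeZero k := ⟨hk.ne'⟩
    obtain ⟨e, he⟩ := hG.1.exists_minor_ne_zero hr
    have hm : reduction p r hr (minor G e) =
        (Matrix.of T).det * reduction p r hr (minor G₀ e) := by
      rw [← minor_map, ← minor_map, hT', minor_mul]
    have h0 := hm ▸ he
    obtain ⟨G₁, hG₁, hle⟩ := hG.1.exists_intDegree_add_le hr hG₀ e he (right_ne_zero_of_mul h0)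
    have hle₁ := hG.2 G₁ hG₁
    rw [hm, natDegree_mul (left_ne_zero_of_mul h0) (right_ne_zero_of_mul h0)] at hle
    have hd : (Matrix.of T).det.natDegree = 0 := by omega
    rw [Polynomial.isUnit_iff_degree_eq_zero, degree_eq_natDegree (left_ne_zero_of_mul h0), hd]
    rfl
  rw [← hspan, ← range_vecMulLinear, ← range_vecMulLinear]
  rintro _ ⟨c, rfl⟩
  refine ⟨c ᵥ* (Matrix.of T)⁻¹, ?_⟩
  rw [Matrix.vecMulLinear_apply, Matrix.vecMulLinear_apply, hT', Matrix.vecMul_vecMul,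
    ← Matrix.mul_assoc, Matrix.nonsing_inv_mul _ hu, Matrix.one_mul]

theorem IsFreeCode.exists_isRIDM {R : Type*} [CommRing R] {C : Submodule R⸨X⸩ (Fin n → R⸨X⸩)}
    (hC : IsFreeCode C k) : ∃ G : Matrix (Fin k) (Fin n) R[X], IsRIDM C G := by
  obtain ⟨G, hG, hmin⟩ := WellFounded.has_min
    (InvImage.wf (intDegree (R := R) (k := k) (n := n)) wellFounded_lt)
    {G | IsGeneratorMatrix C G} hC
  exact ⟨G, hG, fun G' hG' => not_lt.mp (hmin G' hG')⟩

theorem IsGeneratorMatrix.finrank_eq {R : Type*} [CommRing R] [Nontrivial R]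
    {C : Submodule R⸨X⸩ (Fin n → R⸨X⸩)} {G : Matrix (Fin k) (Fin n) R[X]}
    (hG : IsGeneratorMatrix C G) : Module.finrank R⸨X⸩ C = k := by
  rw [← hG.2, finrank_span_eq_card hG.1, Fintype.card_fin]

end ResidueCode


/-! ### Passage from the local rings to the polynomial ring -/

section Localization

variable {S P : Type*} [CommRing S] [CommRing P] [IsDomain P] (ρ : S →+* P) (𝔪 : Ideal P)
  [𝔪.IsPrime]

/-- The localization of `S` at the preimage of a prime under a surjection. -/
abbrev LocalizationComap : Type _ := Localization (𝔪.primeCompl.comap ρ)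

/-- The map induced on localizations. -/
noncomputable def localizationComapMap :
    LocalizationComap ρ 𝔪 →+* Localization.AtPrime 𝔪 :=
  IsLocalization.map (Localization.AtPrime 𝔪) ρ (le_refl (𝔪.primeCompl.comap ρ))

omit [IsDomain P] in
theorem localizationComapMap_algebraMap (x : S) :
    localizationComapMap ρ 𝔪 (algebraMap S _ x) = algebraMap P _ (ρ x) :=
  IsLocalization.map_eq _ x

omit [IsDomain P] in
theorem localizationComapMap_surjective (hρ : Function.Surjective ρ) :
    Function.Surjective (localizationComapMap ρ 𝔪) := by
  intro b
  obtain ⟨y, ⟨s, hs⟩, rfl⟩ := IsLocalization.exists_mk'_eq 𝔪.primeCompl b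
  obtain ⟨y, rfl⟩ := hρ y
  obtain ⟨s, rfl⟩ := hρ s
  exact ⟨IsLocalization.mk' _ y (⟨s, hs⟩ : 𝔪.primeCompl.comap ρ), IsLocalization.map_mk' _ _ _⟩

theorem localizationComapMap_eq_zero_iff {q : S} (hq : ∀ x, ρ x = 0 ↔ q ∣ x)
    (a : LocalizationComap ρ 𝔪) :
    localizationComapMap ρ 𝔪 a = 0 ↔ algebraMap S _ q ∣ a := by
  constructor
  · obtain ⟨x, s, rfl⟩ := IsLocalization.exists_mk'_eq (𝔪.primeCompl.comap ρ) a
    intro h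
    rw [localizationComapMap, IsLocalization.map_mk', IsLocalization.mk'_eq_zero_iff] at h
    obtain ⟨t, ht⟩ := h
    have ht0 : (t : P) ≠ 0 := fun h0 => t.2 (h0 ▸ 𝔪.zero_mem)
    obtain ⟨y, rfl⟩ := (hq x).mp ((mul_eq_zero.mp ht).resolve_left ht0)
    exact ⟨IsLocalization.mk' _ y s, by rw [IsLocalization.mul_mk'_eq_mk'_of_mul]⟩
  · rintro ⟨b, rfl⟩
    rw [map_mul, localizationComapMap_algebraMap, (hq q).mpr dvd_rfl, map_zero, zero_mul]

/-- Clearing denominators in the kernel of a matrix. -/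
theorem exists_smul_mem_ker {S A : Type*} [CommRing S] [CommRing A] [Algebra S A]
    (M : Submonoid S) [IsLocalization M A] {k n : ℕ} (G : Matrix (Fin k) (Fin n) S)
    (v : Fin n → A) (hv : G.map (algebraMap S A) *ᵥ v = 0) :
    ∃ (t : M) (x : Fin n → S), G *ᵥ x = 0 ∧ ∀ i, algebraMap S A (x i) = algebraMap S A t * v i := by
  obtain ⟨b, hb⟩ := IsLocalization.exist_integer_multiples_of_finite M v
  choose x hx using hb
  have hx' : algebraMap S A ∘ x = algebraMap S A b • v := funext fun i => by
    rw [Function.comp_apply, hx, Pi.smul_apply, Algebra.smul_def, smul_eq_mul]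
  have h1 : ∀ i, ∃ c : M, (c : S) * (G *ᵥ x) i = 0 := by
    intro i
    rw [← IsLocalization.map_eq_zero_iff M A, RingHom.map_mulVec, hx', Matrix.mulVec_smul, hv,
      smul_zero, Pi.zero_apply]
  choose c hc using h1
  refine ⟨(∏ i, c i) * b, ((∏ i, c i : M) : S) • x, ?_, fun i => ?_⟩
  · rw [Matrix.mulVec_smul]
    funext i
    rw [Pi.smul_apply, smul_eq_mul, Pi.zero_apply, ← Finset.mul_prod_erase _ c (Finset.mem_univ i),
      Submonoid.coe_mul, mul_comm (c i : S), mul_assoc, hc, mul_zero]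
  · rw [Pi.smul_apply, smul_eq_mul, map_mul, hx, Algebra.smul_def, Submonoid.coe_mul, map_mul,
      mul_assoc]

/-- Divisibility is checked at each maximal ideal `𝔪`. Localizing `S` at the preimage of the
complement of `𝔪` keeps the kernel of reduction generated by `q`, and the hypothesis on `ker G`
survives by clearing denominators. -/
theorem dvd_minor_of_span_eq_reduction_ker [IsPrincipalIdealRing P] (hP : ¬ IsField P)
    (hρ : Function.Surjective ρ) {q : S} (hq : ∀ x, ρ x = 0 ↔ q ∣ x) (hnil : IsNilpotent q)
    {k m n : ℕ} (hkm : k + m = n) (G : Matrix (Fin k) (Fin n) S)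
    (hG : ∃ e, minor (G.map ρ) e ≠ 0) (H : Matrix (Fin m) (Fin n) P)
    (hH : ∃ e, minor H e ≠ 0) (hGH : ∀ i, G.map ρ *ᵥ H i = 0)
    (hL : ∀ v, G *ᵥ v = 0 → ρ ∘ v ∈ Submodule.span P (Set.range H.row))
    (d : P) (hd : ∀ e, d ∣ minor H e) (e : Fin k ↪o Fin n) : d ∣ minor (G.map ρ) e := by
  rw [← Ideal.mem_span_singleton]
  refine Ideal.mem_of_localization_maximal fun 𝔪 h𝔪 => ?_
  rw [Ideal.map_span, Set.image_singleton, Ideal.mem_span_singleton]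
  have hbot : 𝔪 ≠ ⊥ := Ring.ne_bot_of_isMaximal_of_not_isField h𝔪 hP
  have : IsDiscreteValuationRing (Localization.AtPrime 𝔪) :=
    IsLocalization.AtPrime.isDiscreteValuationRing_of_dedekind_domain P hbot _
  let A := LocalizationComap ρ 𝔪
  let B := Localization.AtPrime 𝔪
  let _ : Algebra A B := (localizationComapMap ρ 𝔪).toAlgebra
  have hinj : Function.Injective (algebraMap P B) :=
    IsLocalization.injective _ 𝔪.primeCompl_le_nonZeroDivisors
  have hAB : ∀ x : S, algebraMap A B (algebraMap S A x) = algebraMap P B (ρ x) :=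
    localizationComapMap_algebraMap ρ 𝔪
  have hGm : (G.map (algebraMap S A)).map (algebraMap A B) = (G.map ρ).map (algebraMap P B) := by
    ext i j
    exact hAB _
  have key := dvd_minor_of_span_reduction_ker (A := A) (B := B)
    (localizationComapMap_surjective ρ 𝔪 hρ) (hnil.map (algebraMap S A))
    (localizationComapMap_eq_zero_iff ρ 𝔪 hq) hkm (G.map (algebraMap S A))
    (by
      obtain ⟨e, he⟩ := hG
      refine ⟨e, ?_⟩
      rw [hGm, minor_map]
      exact (map_ne_zero_iff _ hinj).mpr he)
    (H.map (algebraMap P B))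
    (by
      obtain ⟨e, he⟩ := hH
      refine ⟨e, ?_⟩
      rw [minor_map]
      exact (map_ne_zero_iff _ hinj).mpr he)
    (by
      intro i
      rw [hGm]
      funext j
      have := congrArg (algebraMap P B) (congrFun (hGH i) j)
      rw [RingHom.map_mulVec] at this
      exact this.trans (map_zero _))
    (by
      intro v hv
      obtain ⟨t, x, hx, htx⟩ := exists_smul_mem_ker (𝔪.primeCompl.comap ρ) G v hv
      have h1 := hL x hx
      rw [← range_vecMulLinear] at h1 ⊢
      obtain ⟨c, hc⟩ := h1
      rw [Matrix.vecMulLinear_apply] at hc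
      have hu : IsUnit (algebraMap P B (ρ t)) :=
        IsLocalization.map_units B (⟨ρ t, t.2⟩ : 𝔪.primeCompl)
      rw [← Submodule.smul_mem_iff_of_isUnit _ hu]
      refine ⟨algebraMap P B ∘ c, ?_⟩
      rw [Matrix.vecMulLinear_apply, map_vecMul_eq, hc]
      funext i
      change algebraMap P B (ρ (x i)) = algebraMap P B (ρ t) * algebraMap A B (v i)
      rw [← hAB, ← hAB, htx, map_mul])
    (algebraMap P B d)
    (by
      intro e
      rw [minor_map]
      exact map_dvd _ (hd e))
    e
  rwa [hGm, minor_map] at key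

end Localization

/-! ### Equality of the residual polynomials -/

section Duality

variable {p r : ℕ} [Fact p.Prime] (hr : 0 < r) {k m n : ℕ}
  {C : Submodule (ZMod (p ^ r))⸨X⸩ (Fin n → (ZMod (p ^ r))⸨X⸩)}

theorem polyToLaurent_comp_mem_dualCode_iff {R : Type*} [CommRing R]
    {C : Submodule R⸨X⸩ (Fin n → R⸨X⸩)} {G : Matrix (Fin k) (Fin n) R[X]}
    (hG : IsGeneratorMatrix C G) (v : Fin n → R[X]) :
    polyToLaurent R ∘ v ∈ dualCode C ↔ G *ᵥ v = 0 := by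
  rw [hG.mem_dualCode_iff, funext_iff, funext_iff]
  refine forall_congr' fun i => ?_
  rw [← RingHom.map_mulVec, Pi.zero_apply, Pi.zero_apply,
    map_eq_zero_iff _ (polyToLaurent_injective R)]

theorem residualPolynomial_dvd_minor (G : Matrix (Fin k) (Fin n) (ZMod (p ^ r))[X])
    (e : Fin k ↪o Fin n) : residualPolynomial p r hr G ∣ minor (G.map (reduction p r hr)) e := by
  let _ : NormalizedGCDMonoid (ZMod p)[X] :=
    UniqueFactorizationMonoid.toNormalizedGCDMonoid (ZMod p)[X]
  exact Finset.gcd_dvd (Finset.mem_univ e)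

/-- Minimality matters only on the dual side, where the rows of `H` mod `p` must span the reductions
of all of `ker G`. -/
theorem residualPolynomial_dvd_of_isRIDM (hkm : k + m = n)
    {G : Matrix (Fin k) (Fin n) (ZMod (p ^ r))[X]} (hG : IsGeneratorMatrix C G)
    {H : Matrix (Fin m) (Fin n) (ZMod (p ^ r))[X]} (hH : IsRIDM (dualCode C) H) :
    residualPolynomial p r hr H ∣ residualPolynomial p r hr G := by
  let _ : NormalizedGCDMonoid (ZMod p)[X] :=
    UniqueFactorizationMonoid.toNormalizedGCDMonoid (ZMod p)[X]
  refine Finset.dvd_gcd fun e _ => ?_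
  refine dvd_minor_of_span_eq_reduction_ker (reduction p r hr) (Polynomial.not_isField _)
    (reduction_surjective hr) (reduction_eq_zero_iff hr) (isNilpotent_natCast (r := r) _) hkm G
    ((linearIndependent_row_polyToLaurent_iff hr G).mp hG.1) (H.map (reduction p r hr))
    ((linearIndependent_row_polyToLaurent_iff hr H).mp hH.1.1) (fun i => ?_) (fun v hv => ?_)
    _ (residualPolynomial_dvd_minor hr H) e
  · have h := (polyToLaurent_comp_mem_dualCode_iff hG _).mp (hH.1.row_mem i)
    funext j
    have h1 := congrArg (reduction p r hr) (congrFun h j)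
    rw [RingHom.map_mulVec] at h1
    exact h1.trans (map_zero _)
  · rw [hH.span_reduction_eq hr]
    exact ⟨v, (polyToLaurent_comp_mem_dualCode_iff hG _).mpr hv, rfl⟩

theorem residualPolynomial_eq_of_isRIDM (hkm : k + m = n)
    {G : Matrix (Fin k) (Fin n) (ZMod (p ^ r))[X]} (hG : IsRIDM C G)
    {H : Matrix (Fin m) (Fin n) (ZMod (p ^ r))[X]} (hH : IsRIDM (dualCode C) H) :
    residualPolynomial p r hr G = residualPolynomial p r hr H := by
  have h1 := residualPolynomial_dvd_of_isRIDM hr hkm hG.1 hH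
  have h2 : residualPolynomial p r hr G ∣ residualPolynomial p r hr H := by
    refine residualPolynomial_dvd_of_isRIDM hr ((add_comm m k).trans hkm) hH.1 ?_
    rwa [(hG.1.exists_dual hr).2]
  let _ : NormalizedGCDMonoid (ZMod p)[X] :=
    UniqueFactorizationMonoid.toNormalizedGCDMonoid (ZMod p)[X]
  exact dvd_antisymm_of_normalize_eq Finset.normalize_gcd Finset.normalize_gcd h2 h1

end Duality

end FreeConvCode

theorem mainTheorem4 (p r : ℕ) [Fact p.Prime] (hr : 0 < r) (n k : ℕ)
    (C : Submodule (ZMod (p ^ r))⸨X⸩ (Fin n → (ZMod (p ^ r))⸨X⸩))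
    (hC : FreeConvCode.IsFreeCode C k) :
    FreeConvCode.IsFreeCode (FreeConvCode.dualCode C) (n - k) ∧
    (∀ (G : Matrix (Fin k) (Fin n) (ZMod (p ^ r))[X])
      (H : Matrix (Fin (n - k)) (Fin n) (ZMod (p ^ r))[X]),
      FreeConvCode.IsRIDM C G → FreeConvCode.IsRIDM (FreeConvCode.dualCode C) H →
      FreeConvCode.residualPolynomial p r hr G = FreeConvCode.residualPolynomial p r hr H) ∧
    FreeConvCode.codeResidualPolynomial p r hr C =
      FreeConvCode.codeResidualPolynomial p r hr (FreeConvCode.dualCode C) := by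
  have : Nontrivial (ZMod (p ^ r)) := ZMod.nontrivial_iff.mpr
    (Nat.one_lt_pow hr.ne' (Fact.out : p.Prime).one_lt).ne'
  obtain ⟨G₀, hG₀⟩ := hC
  have hdual := (hG₀.exists_dual hr).1
  obtain ⟨e, -⟩ := hG₀.exists_minor_ne_zero hr
  have hkn : k ≤ n := by simpa using Fintype.card_le_of_embedding e.toEmbedding
  refine ⟨hdual, fun G H hG hH =>
    FreeConvCode.residualPolynomial_eq_of_isRIDM hr (Nat.add_sub_cancel' hkn) hG hH, ?_⟩
  obtain ⟨H₀, hH₀⟩ := hdual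
  have hexC : ∃ (k : ℕ) (G : Matrix (Fin k) (Fin n) (ZMod (p ^ r))[X]), FreeConvCode.IsRIDM C G :=
    ⟨k, FreeConvCode.IsFreeCode.exists_isRIDM ⟨G₀, hG₀⟩⟩
  have hexD : ∃ (k : ℕ) (G : Matrix (Fin k) (Fin n) (ZMod (p ^ r))[X]),
      FreeConvCode.IsRIDM (FreeConvCode.dualCode C) G :=
    ⟨n - k, FreeConvCode.IsFreeCode.exists_isRIDM ⟨H₀, hH₀⟩⟩
  unfold FreeConvCode.codeResidualPolynomial
  rw [dif_pos hexC, dif_pos hexD]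
  have hG := hexC.choose_spec.choose_spec
  have hH := hexD.choose_spec.choose_spec
  refine FreeConvCode.residualPolynomial_eq_of_isRIDM hr ?_ hG hH
  -- The chosen RIDMs come with ranks of their own. These are the ranks of the two codes as free
  -- modules, hence `k` and `n - k`.
  rw [← hG.1.finrank_eq, ← hH.1.finrank_eq, hG₀.finrank_eq, hH₀.finrank_eq]
  exact Nat.add_sub_cancel' hkn
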